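/- Let $e\in(0,1/\sqrt2)$, $b=\sqrt{1-e^2}$, and let $D\subset\mathbb R^2$ be the open domain bounded by the ellipse $\gamma(\xi)=(\cos\xi,\,b\sin\xi)$, $\xi\in\mathbb R/2\pi\mathbb Z$ (centre at the origin, semimajor axis $1$, eccentricity $e$). For $\mathcal E,\omega,h,\mu>0$ put $$V_E(z)=\mathcal E-\tfrac{\omega^2}{2}|z|^2,\qquad V_I(z)=\mathcal E+h+\frac{\mu}{|z|}.$$ Outside $D$ a particle moves by $z''=-\omega^2z$ with $\tfrac12|z'|^2=V_E(z)$; inside $D$ it moves by $z''=-\mu z/|z|^3$ with $\tfrac12|z'|^2=V_I(z)$, collisions with the origin being regularised by reflecting the arc back along itself. At each crossing of $\partial D$ the trajectory is refracted according to Snell's law $\sqrt{V_I}\,\sin\alpha_I=\sqrt{V_E}\,\sin\alpha_E$, where $\alpha_I,\alpha_E\in(-\pi/2,\pi/2)$ are the angles of the inner and of the outer velocity with the normal to $\partial D$. The first return map $\mathcal F$ is the partially defined map of $(\mathbb R/2\pi\mathbb Z)\times(-\pi/2,\pi/2)$ that sends $(\xi_0,\alpha_0)$ to $(\xi_1,\alpha_1)$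 if the trajectory that leaves $D$ at $\gamma(\xi_0)$, with angle $\alpha_0$ to the outward normal, makes one outer arc up to its first return to $\partial D$, is refracted into $D$, makes one inner arc up to its first return to $\partial D$, and is refracted out of $D$ at $\gamma(\xi_1)$ with angle $\alpha_1$ to the outward normal. A two-periodic brake trajectory is an orbit $\{P,Q\}$ of $\mathcal F$ of minimal period two ($\mathcal F(P)=Q\ne P$, $\mathcal F(Q)=P$) such that the two outer arcs are homothetic brake arcs (they run along the half-line from the origin through their starting point, and their velocity vanishes at an intermediate time) and the inner arcs lie on nondegenerate Keplerian hyperbolae with focus at the origin. **Theorem.** Let $\mathcal E,\omega>0$ with $\omega^2/2<\mathcal E<\omega^2$ and let $e\in(0,1/\sqrt2)$. Then, if $\mu$ is sufficiently large and $h$ is sufficiently large with respect to $\mu$, the first return map has at least four distinct two-periodic brake trajectories. More precisely, there are $\mu_0,C>0$, depending only on $\mathcal E,\omega,e$, such that for all $\mu>\mu_0$ and all $h>C\mu$ there are four two-periodic brake trajectories whose orbits in the phase space are pairwise disjoint. -/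

import Mathlib

/-!
Refraction billiard with an elliptic interface: outside the ellipse a harmonic oscillator of energy
`E` and frequency `ω`, inside it a Kepler problem of energy `E + h` and mass parameter `μ`.
-/

noncomputable section

namespace RefractionBilliard

/-- The Euclidean plane. -/
abbrev Plane : Type := EuclideanSpace ℝ (Fin 2)

/-- Semiminor axis of the ellipse with semimajor axis `1` and eccentricity `e`. -/
def semiMinor (e : ℝ) : ℝ := Real.sqrt (1 - e ^ 2)

/-- The open elliptic domain `D`, centred at the origin. -/
def domain (e : ℝ) : Set Plane := {z | z 0 ^ 2 + z 1 ^ 2 / semiMinor e ^ 2 < 1}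

/-- The parametrisation `ξ ↦ (cos ξ, b sin ξ)` of the interface `∂D`. -/
def bdry (e : ℝ) (ξ : Real.Angle) : Plane := !₂[ξ.cos, semiMinor e * ξ.sin]

/-- The speed `|γ'(ξ)|` of the parametrisation. -/
def bdrySpeed (e : ℝ) (ξ : Real.Angle) : ℝ :=
  Real.sqrt (ξ.sin ^ 2 + semiMinor e ^ 2 * ξ.cos ^ 2)

/-- The unit tangent vector `γ'(ξ) / |γ'(ξ)|`. -/
def tangent (e : ℝ) (ξ : Real.Angle) : Plane :=
  (bdrySpeed e ξ)⁻¹ • !₂[-ξ.sin, semiMinor e * ξ.cos]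

/-- The outward unit normal vector at `γ(ξ)`. -/
def normal (e : ℝ) (ξ : Real.Angle) : Plane :=
  (bdrySpeed e ξ)⁻¹ • !₂[semiMinor e * ξ.cos, ξ.sin]

/-- The outer potential `V_E`. -/
def outerPot (E ω : ℝ) (z : Plane) : ℝ := E - ω ^ 2 / 2 * ‖z‖ ^ 2

/-- The inner potential `V_I`. -/
def innerPot (E h μ : ℝ) (z : Plane) : ℝ := E + h + μ / ‖z‖

/-- The velocity at `γ(ξ)` that satisfies the zero energy relation `|v|² / 2 = V`, points out of
`D`, and makes the angle `α` with the outward normal. -/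
def exitVelocity (e V : ℝ) (ξ : Real.Angle) (α : ℝ) : Plane :=
  Real.sqrt (2 * V) • (Real.cos α • normal e ξ + Real.sin α • tangent e ξ)

/-- The velocity at `γ(ξ)` that satisfies the zero energy relation `|v|² / 2 = V`, points into
`D`, and makes the angle `α` with the inward normal. -/
def entryVelocity (e V : ℝ) (ξ : Real.Angle) (α : ℝ) : Plane :=
  Real.sqrt (2 * V) • (-(Real.cos α • normal e ξ) + Real.sin α • tangent e ξ)

/-- The range `(-π/2, π/2)` of the angles with the normal direction. -/
def angleRange : Set ℝ := Set.Ioo (-(Real.pi / 2)) (Real.pi / 2)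

/-- The phase space of the first return map consists of the pairs `(ξ, α)`: position `γ(ξ)` on the
interface, and angle `α` between the outgoing velocity and the outward normal. -/
abbrev PhasePoint : Type := Real.Angle × ℝ

/-- Snell's law at `γ(ξ)` between the outer angle `αE` and the inner angle `αI`. -/
def Snell (E ω h μ e : ℝ) (ξ : Real.Angle) (αE αI : ℝ) : Prop :=
  Real.sqrt (innerPot E h μ (bdry e ξ)) * Real.sin αI
    = Real.sqrt (outerPot E ω (bdry e ξ)) * Real.sin αE

/-- `z`, with velocity `w`, is on `[0, T]` the outer arc that leaves the interface at `(ξ, α)` and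
comes back to it for the first time at time `T`, at `γ(ξ')` and with angle `α'`. -/
structure IsOuterArc (E ω e : ℝ) (ξ : Real.Angle) (α : ℝ) (ξ' : Real.Angle) (α' : ℝ)
    (T : ℝ) (z w : ℝ → Plane) : Prop where
  pos : 0 < T
  deriv_pos : ∀ t ∈ Set.Icc 0 T, HasDerivWithinAt z (w t) (Set.Icc 0 T) t
  deriv_vel : ∀ t ∈ Set.Icc 0 T, HasDerivWithinAt w (-(ω ^ 2) • z t) (Set.Icc 0 T) t
  start_pos : z 0 = bdry e ξ
  start_vel : w 0 = exitVelocity e (outerPot E ω (bdry e ξ)) ξ α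
  outside : ∀ t ∈ Set.Ioo 0 T, z t ∉ closure (domain e)
  end_pos : z T = bdry e ξ'
  end_vel : w T = entryVelocity e (outerPot E ω (bdry e ξ')) ξ' α'

/-- `z`, with velocity `w`, is on `[0, T]` the inner arc that enters `D` at `(ξ, α)` and reaches the
interface for the first time at time `T`, at `γ(ξ')` and with angle `α'`. Collisions with the
centre are regularised: after a collision the arc is run through backwards. -/
structure IsInnerArc (E h μ e : ℝ) (ξ : Real.Angle) (α : ℝ) (ξ' : Real.Angle) (α' : ℝ)
    (T : ℝ) (z w : ℝ → Plane) : Prop where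
  pos : 0 < T
  cont : ContinuousOn z (Set.Icc 0 T)
  deriv_pos : ∀ t ∈ Set.Icc 0 T, z t ≠ 0 → HasDerivWithinAt z (w t) (Set.Icc 0 T) t
  deriv_vel : ∀ t ∈ Set.Icc 0 T, z t ≠ 0 →
    HasDerivWithinAt w (-(μ / ‖z t‖ ^ 3) • z t) (Set.Icc 0 T) t
  collision : ∀ t ∈ Set.Icc 0 T, z t = 0 →
    ∀ s : ℝ, t + s ∈ Set.Icc 0 T → t - s ∈ Set.Icc 0 T → z (t + s) = z (t - s)
  start_pos : z 0 = bdry e ξ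
  start_vel : w 0 = entryVelocity e (innerPot E h μ (bdry e ξ)) ξ α
  inside : ∀ t ∈ Set.Ioo 0 T, z t ∈ domain e
  end_pos : z T = bdry e ξ'
  end_vel : w T = exitVelocity e (innerPot E h μ (bdry e ξ')) ξ' α'

/-- A concatenation from `P` to `Q`: an outer arc, a refraction from outside to inside, an inner
arc, and a refraction from inside to outside. -/
structure Concatenation (E ω h μ e : ℝ) (P Q : PhasePoint) where
  /-- Position of the transition point between the two arcs. -/
  ξm : Real.Angle
  /-- Outer and inner angle at the transition point, and inner angle at the final point. -/
  (αE αI αF : ℝ)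
  /-- Durations of the two arcs. -/
  (TE TI : ℝ)
  /-- The outer arc and its velocity. -/
  (zE wE : ℝ → Plane)
  /-- The inner arc and its velocity. -/
  (zI wI : ℝ → Plane)
  mem_P : P.2 ∈ angleRange
  mem_E : αE ∈ angleRange
  mem_I : αI ∈ angleRange
  mem_F : αF ∈ angleRange
  mem_Q : Q.2 ∈ angleRange
  outerArc : IsOuterArc E ω e P.1 P.2 ξm αE TE zE wE
  snell_in : Snell E ω h μ e ξm αE αI
  innerArc : IsInnerArc E h μ e ξm αI Q.1 αF TI zI wI
  snell_out : Snell E ω h μ e Q.1 Q.2 αF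

/-- The graph of the first return map `F`: `F P` is defined and equal to `Q`. (The arcs, and hence
`Q`, are determined by `P`, by uniqueness of solutions and minimality of the return times.) -/
def FirstReturn (E ω h μ e : ℝ) (P Q : PhasePoint) : Prop :=
  Nonempty (Concatenation E ω h μ e P Q)

/-- The outer arc is a homothetic brake arc: it stays on the half-line from the origin through its
starting point, and its velocity vanishes at some intermediate time. -/
def Concatenation.OuterHomothetic {E ω h μ e : ℝ} {P Q : PhasePoint}
    (c : Concatenation E ω h μ e P Q) : Prop :=
  (∀ t ∈ Set.Icc 0 c.TE, ∃ r : ℝ, 0 < r ∧ c.zE t = r • bdry e P.1) ∧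
    ∃ t ∈ Set.Ioo 0 c.TE, c.wE t = 0

/-- The inner arc lies on a (nondegenerate) branch of hyperbola with focus at the origin: in polar
coordinates `r = ℓ / (1 + ε cos ν)` with `ℓ > 0`, where the eccentricity `ε = ‖A‖` is greater than
`1` and `ν` is the angle from `A`. -/
def Concatenation.InnerHyperbolic {E ω h μ e : ℝ} {P Q : PhasePoint}
    (c : Concatenation E ω h μ e P Q) : Prop :=
  ∃ (A : Plane) (l : ℝ), 1 < ‖A‖ ∧ 0 < l ∧
    ∀ t ∈ Set.Icc 0 c.TI, ‖c.zI t‖ + inner ℝ A (c.zI t) = l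

/-- `P, Q` is a two-periodic brake trajectory: an orbit of minimal period two of the first return
map, `F P = Q ≠ P` and `F Q = P`, whose outer arcs are homothetic and whose inner arcs are
hyperbolic. -/
def IsTwoPeriodicBrake (E ω h μ e : ℝ) (P Q : PhasePoint) : Prop :=
  P ≠ Q ∧ FirstReturn E ω h μ e P Q ∧ FirstReturn E ω h μ e Q P ∧
    (∃ c : Concatenation E ω h μ e P Q, c.OuterHomothetic ∧ c.InnerHyperbolic) ∧
    (∃ c : Concatenation E ω h μ e Q P, c.OuterHomothetic ∧ c.InnerHyperbolic)

end RefractionBilliard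

end

/-! A homothetic brake arc leaves the interface radially and returns to the same point with reversed
velocity, and the Kepler flow is reversible. So a single Kepler arc between two points of the
ellipse, traversed forwards and then backwards, closes up to a two-periodic orbit as soon as its end
velocities have the tangential components of the radial outer velocities; Snell's law asks for
nothing else (`IsBrakeLink.exists_isTwoPeriodicBrake`).

Such an arc is found by perturbing a singular limit. A hyperbola `‖z‖ + ⟪A, z⟫ = l` of energy `H = E
+ h` has `l = σ (‖A‖² - 1)` with `σ = μ / (2H)`. In the regime considered, `σ` and `κ = 1 / √(2H)`
are both small. For `σ = 0` and `A = (-1, -1)` the conic degenerates to `‖z‖ = x + y`, the two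
positive half-axes joined at the origin. The arc sought comes in near `(1, 0)`, swings round the
focus and leaves near `(0, b)`. At these vertices the radial direction is normal, so the correct
displacement of the end points is of order `σ`. After this rescaling and division by `σ`, the
matching conditions `linkEquations` have a zero with invertible derivative at `κ = σ = 0`, and it
persists (`eventually_exists_linkEquations_eq_zero`).

The bound `e² < 1/2` makes `x² + y²/b²` strictly convex along Kepler orbits of positive energy,
which keeps the arc inside the ellipse (`kepler_arc_inside_ellipse`). The reflections in the axes
turn one arc into four (`IsBrakeLink.exists_four`). -/

namespace RefractionBilliard

/-! ### Implicit functions and the rescaled matching equations -/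

open Filter Topology in
/-- If the partial derivative in the second variable is surjective at a zero, then the zero
persists for nearby values of the first variable. -/
theorem eventually_exists_zero_of_surjective_partial {X Y Z : Type*}
    [NormedAddCommGroup X] [NormedSpace ℝ X] [CompleteSpace X]
    [NormedAddCommGroup Y] [NormedSpace ℝ Y] [CompleteSpace Y]
    [NormedAddCommGroup Z] [NormedSpace ℝ Z] [CompleteSpace Z]
    {F : X × Y → Z} {a : X} {b : Y} {L : Y →L[ℝ] Z} {p : X × Y → Prop}
    (hF : ContDiffAt ℝ 1 F (a, b)) (hL : HasFDerivAt (fun y => F (a, y)) L b)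
    (hsurj : Function.Surjective L) (h0 : F (a, b) = 0) (hp : ∀ᶠ z in 𝓝 (a, b), p z) :
    ∀ᶠ x in 𝓝 a, ∃ y, F (x, y) = 0 ∧ p (x, y) := by
  have hs := hF.hasStrictFDerivAt one_ne_zero
  set F' := fderiv ℝ F (a, b)
  have hL' : L = F' ∘L .inr ℝ X Y :=
    hL.unique (hs.hasFDerivAt.comp b (hasFDerivAt_prodMk_right a b))
  -- The augmented map `(x, y) ↦ (x, F (x, y))` has surjective derivative, hence is open at `(a,
  -- b)`; its values near `(a, 0)` include every `(x, 0)` with `x` close to `a`.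
  have hG : HasStrictFDerivAt (fun z : X × Y => (z.1, F z))
      ((ContinuousLinearMap.fst ℝ X Y).prod F') (a, b) := hasStrictFDerivAt_fst.prodMk hs
  have hGs : ((ContinuousLinearMap.fst ℝ X Y).prod F').range = ⊤ := by
    rw [LinearMap.range_eq_top]
    rintro ⟨x, z⟩
    obtain ⟨d, hd⟩ := hsurj (z - F' (x, 0))
    refine ⟨(x, d), ?_⟩
    have hd' : F' (0, d) = z - F' (x, 0) := by rw [← hd, hL']; simp
    have : F' (x, d) = F' (x, 0) + F' (0, d) := by rw [← map_add]; simp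
    simp [this, hd']
  have hmap := hG.map_nhds_eq_of_surj hGs
  have himg : (fun z : X × Y => (z.1, F z)) '' {z | p z} ∈ 𝓝 (a, F (a, b)) := by
    rw [← hmap]; exact image_mem_map hp
  rw [h0] at himg
  have hc : Tendsto (fun x : X => (x, (0 : Z))) (𝓝 a) (𝓝 (a, 0)) :=
    (Continuous.prodMk_left (0 : Z)).tendsto a
  filter_upwards [hc himg] with x hx
  obtain ⟨⟨x', y⟩, hpy, hxy⟩ := hx
  simp only [Prod.mk.injEq] at hxy
  obtain ⟨rfl, hy⟩ := hxy
  exact ⟨y, hy, hpy⟩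

/-- The equations for a hyperbola `‖z‖ + ⟪A, z⟫ = σ (‖A‖² - 1)` through the points
`(√(1 - σ² y₀²), b σ y₀)` and `(-σ y₁, b √(1 - σ² y₁²))` of an ellipse whose velocities there match
radial outer velocities. The unknowns are `A₁, A₂, y₀, y₁`, the parameters `κ, σ`. -/
noncomputable def linkEquations (e b E ω : ℝ) (z : (ℝ × ℝ) × (ℝ × ℝ × ℝ × ℝ)) : ℝ × ℝ × ℝ × ℝ :=
  let κ := z.1.1
  let σ := z.1.2
  let A₁ := z.2.1
  let A₂ := z.2.2.1
  let y₀ := z.2.2.2.1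
  let y₁ := z.2.2.2.2
  let c₀ := √(1 - σ ^ 2 * y₀ ^ 2)
  let c₁ := √(1 - σ ^ 2 * y₁ ^ 2)
  let r₀ := √(c₀ ^ 2 + (b * (σ * y₀)) ^ 2)
  let r₁ := √((-(σ * y₁)) ^ 2 + (b * c₁) ^ 2)
  -- The semilatus rectum of the conic is `σ * l`, not `l`. The last two components are the
  -- tangential conditions divided by `σ`, up to sign, and by `√(μ / (σ * l))`, whose inverse is `√l
  -- * κ`.
  let l := A₁ ^ 2 + A₂ ^ 2 - 1
  (r₀ + (A₁ * c₀ + A₂ * (b * (σ * y₀))) - σ * l,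
    r₁ + (A₁ * (-(σ * y₁)) + A₂ * (b * c₁)) - σ * l,
    e ^ 2 * y₀ * c₀ * (-A₁ * (b * (σ * y₀)) + A₂ * c₀
      + r₀ * √l * κ * √(2 * E - ω ^ 2 * r₀ ^ 2)) + b * l,
    e ^ 2 * y₁ * c₁ * (-A₁ * (b * c₁) + A₂ * (-(σ * y₁))
      - r₁ * √l * κ * √(2 * E - ω ^ 2 * r₁ ^ 2)) - b * l)

/-- At the base point the radicands are `1`, `b²`, `2E - ω²` and `2E - ω² b²`, all positive, so
every square root is smooth there, even at `κ = σ = 0`. -/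
theorem linkEquations_contDiffAt {e b E ω : ℝ} (hb : 0 < b) (hE : ω ^ 2 < 2 * E)
    (hE' : ω ^ 2 * b ^ 2 < 2 * E) (y₀ y₁ : ℝ) :
    ContDiffAt ℝ 1 (linkEquations e b E ω) ((0, 0), (-1, -1, y₀, y₁)) := by
  unfold linkEquations
  have hb2 : b ^ 2 ≠ 0 := by positivity
  fun_prop (disch := first | (simp; done) | (simp [hb.le, hb.ne']; done) | (simp [hb.le]; linarith) | (norm_num; done) | (simp [hb.le]; nlinarith))

open Filter Topology in
theorem eventually_exists_linkEquations_eq_zero {e b E ω : ℝ} (he : 0 < e) (hb : 0 < b)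
    (hE : ω ^ 2 < 2 * E) (hE' : ω ^ 2 * b ^ 2 < 2 * E)
    {p : (ℝ × ℝ) × (ℝ × ℝ × ℝ × ℝ) → Prop}
    (hp : ∀ᶠ z in 𝓝 (((0, 0), (-1, -1, b / e ^ 2, 1 / e ^ 2)) : (ℝ × ℝ) × (ℝ × ℝ × ℝ × ℝ)), p z) :
    ∀ᶠ x in 𝓝 ((0, 0) : ℝ × ℝ), ∃ y, linkEquations e b E ω (x, y) = 0 ∧ p (x, y) := by
  -- At `κ = σ = 0` the roots of the end-point data become constants and `√l` is multiplied by zero,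
  -- which leaves a polynomial system.
  have h1 : (fun y : ℝ × ℝ × ℝ × ℝ => linkEquations e b E ω ((0, 0), y)) = fun y =>
      (1 + y.1, b + b * y.2.1, e ^ 2 * (y.2.2.1 * y.2.1) + b * (y.1 ^ 2 + y.2.1 ^ 2 - 1),
        -(e ^ 2 * b) * (y.2.2.2 * y.1) - b * (y.1 ^ 2 + y.2.1 ^ 2 - 1)) := by
    funext y
    simp only [linkEquations, Prod.mk.injEq]
    refine ⟨?_, ?_, ?_, ?_⟩ <;> simp [hb.le] <;> ring
  have hfst : ∀ y : ℝ × ℝ × ℝ × ℝ, HasFDerivAt (fun y : ℝ × ℝ × ℝ × ℝ => y.1) (.fst ℝ ℝ _) y :=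
    fun y => hasFDerivAt_fst
  have h2 : ∀ y : ℝ × ℝ × ℝ × ℝ, HasFDerivAt (fun y : ℝ × ℝ × ℝ × ℝ => y.2.1)
    ((ContinuousLinearMap.fst ℝ ℝ _).comp (.snd ℝ ℝ (ℝ × ℝ × ℝ))) y :=
    fun y => hasFDerivAt_fst.comp y hasFDerivAt_snd
  have h3 : ∀ y : ℝ × ℝ × ℝ × ℝ, HasFDerivAt (fun y : ℝ × ℝ × ℝ × ℝ => y.2.2.1)
    ((ContinuousLinearMap.fst ℝ ℝ _).comp ((ContinuousLinearMap.snd ℝ ℝ (ℝ × ℝ)).comp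
      (.snd ℝ ℝ (ℝ × ℝ × ℝ)))) y :=
    fun y => hasFDerivAt_fst.comp y (hasFDerivAt_snd.comp y hasFDerivAt_snd)
  have h4 : ∀ y : ℝ × ℝ × ℝ × ℝ, HasFDerivAt (fun y : ℝ × ℝ × ℝ × ℝ => y.2.2.2)
    ((ContinuousLinearMap.snd ℝ ℝ _).comp ((ContinuousLinearMap.snd ℝ ℝ (ℝ × ℝ)).comp
      (.snd ℝ ℝ (ℝ × ℝ × ℝ)))) y :=
    fun y => hasFDerivAt_snd.comp y (hasFDerivAt_snd.comp y hasFDerivAt_snd)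
  set y : ℝ × ℝ × ℝ × ℝ := (-1, -1, b / e ^ 2, 1 / e ^ 2) with hy
  have hq := (((hfst y).pow 2).add ((h2 y).pow 2)).sub_const 1
  have hL := ((hfst y).const_add 1).prodMk ((((h2 y).const_mul b).const_add b).prodMk
    (((((h3 y).mul (h2 y)).const_mul (e ^ 2)).add (hq.const_mul b)).prodMk
      ((((h4 y).mul (hfst y)).const_mul (-(e ^ 2 * b))).sub (hq.const_mul b))))
  refine eventually_exists_zero_of_surjective_partial
    (linkEquations_contDiffAt hb hE hE' _ _) (h1 ▸ hL) ?_ ?_ hp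
  · rintro ⟨q₁, q₂, q₃, q₄⟩
    -- The derivative is triangular: the first two equations give the increments of `A₁, A₂`, the
    -- other two then give those of `y₀, y₁`.
    refine ⟨(q₁, q₂ / b, (b / e ^ 2) * (q₂ / b) - (q₃ + b * (2 * q₁ + 2 * (q₂ / b))) / e ^ 2,
      (q₄ - b * (2 * q₁ + 2 * (q₂ / b))) / (e ^ 2 * b) + q₁ / e ^ 2), ?_⟩
    simp [hy]
    refine ⟨?_, ?_, ?_⟩ <;> field_simp <;> ring
  · refine (congrFun h1 y).trans ?_
    simp [hy]
    constructor <;> field_simp <;> ring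

/-! ### Kepler hyperbolae in the hyperbolic anomaly -/

/-- The time parametrisation of a Kepler hyperbola: Kepler's equation can be inverted. -/
theorem exists_hyperbolic_anomaly {ε n F₀ F₁ : ℝ} (hε : 1 < ε) (hn : 0 < n) (hF : F₀ < F₁) :
    ∃ (T : ℝ) (G : ℝ → ℝ), 0 < T ∧ G 0 = F₀ ∧ G T = F₁ ∧
      ∀ t, HasDerivAt G (n / (ε * Real.cosh (G t) - 1)) t := by
  have hpos : ∀ F, 0 < ε * Real.cosh F - 1 := fun F => by nlinarith [Real.one_le_cosh F]
  -- Kepler's equation: `τ` is time as a function of the anomaly. It increases and grows at least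
  -- linearly at both ends, so it is a bijection of the line, and `G` is its inverse.
  set τ : ℝ → ℝ := fun F => ((ε * Real.sinh F - F) - (ε * Real.sinh F₀ - F₀)) / n with hτ
  have hder : ∀ F, HasDerivAt τ ((ε * Real.cosh F - 1) / n) F := fun F =>
    ((((Real.hasDerivAt_sinh F).const_mul ε).sub (hasDerivAt_id F)).sub_const _).div_const n
  have hmono : StrictMono τ := strictMono_of_hasDerivAt_pos hder fun F => div_pos (hpos F) hn
  have hcont : Continuous τ := continuous_iff_continuousAt.2 fun F => (hder F).continuousAt
  have hlow : ∀ F, 0 ≤ F → (ε - 1) * F ≤ ε * Real.sinh F - F := fun F h => by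
    nlinarith [Real.self_le_sinh_iff.2 h]
  have hhigh : ∀ F, F ≤ 0 → ε * Real.sinh F - F ≤ (ε - 1) * F := fun F h => by
    nlinarith [Real.sinh_le_self_iff.2 h]
  have hε' : 0 < ε - 1 := by linarith
  have htop : Filter.Tendsto τ Filter.atTop Filter.atTop := by
    refine Filter.Tendsto.atTop_div_const hn (Filter.tendsto_atTop_add_const_right _ _ ?_)
    refine Filter.tendsto_atTop_mono' _ ?_ (Filter.tendsto_id.const_mul_atTop hε')
    filter_upwards [Filter.eventually_ge_atTop 0] with F h using hlow F h
  have hbot : Filter.Tendsto τ Filter.atBot Filter.atBot := by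
    refine Filter.Tendsto.atBot_div_const hn (Filter.tendsto_atBot_add_const_right _ _ ?_)
    refine Filter.tendsto_atBot_mono' _ ?_ (Filter.tendsto_id.const_mul_atBot hε')
    filter_upwards [Filter.eventually_le_atBot 0] with F h using hhigh F h
  have hsurj : Function.Surjective τ := hcont.surjective htop hbot
  let g := hmono.orderIsoOfSurjective τ hsurj
  have hg : ∀ F, g F = τ F := fun F => rfl
  have hτ0 : τ F₀ = 0 := by simp [hτ]
  refine ⟨τ F₁, g.symm, by rw [← hτ0]; exact hmono hF, ?_, ?_, fun t => ?_⟩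
  · rw [← hτ0, ← hg, g.symm_apply_apply]
  · rw [← hg, g.symm_apply_apply]
  · have := (hder (g.symm t)).of_local_left_inverse g.symm.continuous.continuousAt
      (div_pos (hpos _) hn).ne' (Filter.Eventually.of_forall fun s => g.apply_symm_apply s)
    rwa [inv_div] at this

/-- A point of the conic `‖z‖ + ⟪A, z⟫ = l` in the frame of the unit vector `A / ‖A‖` is determined
by its transversal coordinate. -/
theorem conic_axial_eq {ε l B a α β S : ℝ} (hε : 1 < ε) (hl : 0 < l) (hB : 0 < B)
    (hB2 : B ^ 2 = ε ^ 2 - 1) (ha : a * B ^ 2 = l) (hconic : √(α ^ 2 + β ^ 2) + ε * α = l)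
    (hS : β = -(a * B * S)) : α = a * (ε - √(1 + S ^ 2)) := by
  have ha0 : 0 < a := by
    by_contra h
    nlinarith [sq_nonneg B]
  have hr := Real.sq_sqrt (by positivity : 0 ≤ α ^ 2 + β ^ 2)
  have hr0 := Real.sqrt_nonneg (α ^ 2 + β ^ 2)
  set r := √(α ^ 2 + β ^ 2)
  have hC := Real.sq_sqrt (by positivity : 0 ≤ 1 + S ^ 2)
  have hC0 := Real.sqrt_nonneg (1 + S ^ 2)
  set C := √(1 + S ^ 2)
  have hrα : r = l - ε * α := by linarith
  have hsq : (ε * a - α) ^ 2 = (a * C) ^ 2 := by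
    have h1 : (l - ε * α) ^ 2 = α ^ 2 + β ^ 2 := by rw [← hrα, hr]
    have h2 : B ^ 2 * ((ε * a - α) ^ 2) = B ^ 2 * (a * C) ^ 2 := by
      rw [mul_pow a C, hC]
      rw [hS] at h1
      have h3 : l = a * (ε ^ 2 - 1) := by rw [← ha, hB2]
      rw [h3] at h1
      have : (a * B * S) ^ 2 = a ^ 2 * (ε ^ 2 - 1) * S ^ 2 := by rw [← hB2]; ring
      rw [hB2]
      nlinarith
    exact mul_left_cancel₀ (by positivity) h2
  -- Squaring admits both branches of the hyperbola; `r = l - ε α ≥ 0` selects the one around the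
  -- focus.
  have hnn : 0 ≤ ε * a - α := by
    have : 0 ≤ l - ε * α := hrα ▸ hr0
    rw [← ha, hB2] at this
    nlinarith
  have := (sq_eq_sq₀ hnn (by positivity)).1 hsq
  linarith

/-- A Kepler hyperbola with negative angular momentum, parametrised by time through the hyperbolic
anomaly `G`. -/
theorem kepler_hyperbola_solution {ε c s B a k : ℝ} {G x y u v : ℝ → ℝ} (hε : 1 < ε) (ha : 0 < a)
    (hB : 0 < B) (hB2 : B ^ 2 = ε ^ 2 - 1) (hcs : c ^ 2 + s ^ 2 = 1)
    (hG : ∀ t, HasDerivAt G (k / a / (ε * Real.cosh (G t) - 1)) t)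
    (hx : x = fun t => a * ((ε - Real.cosh (G t)) * c + B * Real.sinh (G t) * s))
    (hy : y = fun t => a * ((ε - Real.cosh (G t)) * s - B * Real.sinh (G t) * c))
    (hu : u = fun t => k * (-Real.sinh (G t) * c + B * Real.cosh (G t) * s)
      / (ε * Real.cosh (G t) - 1))
    (hv : v = fun t => k * (-Real.sinh (G t) * s - B * Real.cosh (G t) * c)
      / (ε * Real.cosh (G t) - 1)) (t : ℝ) :
    0 < x t ^ 2 + y t ^ 2 ∧
      HasDerivAt x (u t) t ∧ HasDerivAt y (v t) t ∧
      HasDerivAt u (-(k ^ 2 * a / √(x t ^ 2 + y t ^ 2) ^ 3) * x t) t ∧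
      HasDerivAt v (-(k ^ 2 * a / √(x t ^ 2 + y t ^ 2) ^ 3) * y t) t ∧
      √(x t ^ 2 + y t ^ 2) + (ε * c * x t + ε * s * y t) = a * B ^ 2 ∧
      u t ^ 2 + v t ^ 2 = k ^ 2 + 2 * (k ^ 2 * a / √(x t ^ 2 + y t ^ 2)) ∧
      u t = k / B * (ε * s + y t / √(x t ^ 2 + y t ^ 2)) ∧
      v t = -(k / B * (ε * c + x t / √(x t ^ 2 + y t ^ 2))) := by
  have hp : 0 < ε * Real.cosh (G t) - 1 := by nlinarith [Real.one_le_cosh (G t)]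
  have hCS : Real.cosh (G t) ^ 2 - Real.sinh (G t) ^ 2 = 1 := Real.cosh_sq_sub_sinh_sq _
  have hch : HasDerivAt (fun t => Real.cosh (G t)) _ t := (hG t).cosh
  have hsh : HasDerivAt (fun t => Real.sinh (G t)) _ t := (hG t).sinh
  have hden : HasDerivAt (fun t => ε * Real.cosh (G t) - 1) _ t := (hch.const_mul ε).sub_const 1
  have hr2 : x t ^ 2 + y t ^ 2 = (a * (ε * Real.cosh (G t) - 1)) ^ 2 := by
    simp only [hx, hy]
    linear_combination (a ^ 2 * ((ε - Real.cosh (G t)) ^ 2 + B ^ 2 * Real.sinh (G t) ^ 2)) * hcs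
      + a ^ 2 * Real.sinh (G t) ^ 2 * hB2 + a ^ 2 * (1 - ε ^ 2) * hCS
  have hr : √(x t ^ 2 + y t ^ 2) = a * (ε * Real.cosh (G t) - 1) := by
    rw [hr2, Real.sqrt_sq (mul_pos ha hp).le]
  have hdx : HasDerivAt x (u t) t := by
    rw [hx, hu]
    refine ((((hch.const_sub ε).mul_const c).add
      ((hsh.const_mul B).mul_const s)).const_mul a).congr_deriv ?_
    field_simp
  have hdy : HasDerivAt y (v t) t := by
    rw [hy, hv]
    refine ((((hch.const_sub ε).mul_const s).sub
      ((hsh.const_mul B).mul_const c)).const_mul a).congr_deriv ?_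
    field_simp
  have hdu := (((hsh.neg.mul_const c).add
      ((hch.const_mul B).mul_const s)).const_mul k).div hden hp.ne'
  have hdv := (((hsh.neg.mul_const s).sub
      ((hch.const_mul B).mul_const c)).const_mul k).div hden hp.ne'
  obtain ⟨D, hD⟩ : ∃ D, D = ε * Real.cosh (G t) - 1 := ⟨_, rfl⟩
  have hD0 : D ≠ 0 := hD ▸ hp.ne'
  rw [hr]
  refine ⟨by rw [hr2]; positivity, hdx, hdy, ?_, ?_, ?_, ?_, ?_, ?_⟩
  · rw [hu, hx]
    refine hdu.congr_deriv ?_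
    simp only [Pi.add_apply, Pi.neg_apply, ← hD]
    clear hdu hdv hdx hdy hden hr hr2 hG
    field_simp
    rw [hD]
    linear_combination (-k ^ 2 * ε * c) * hCS
  · rw [hv, hy]
    refine hdv.congr_deriv ?_
    simp only [Pi.sub_apply, Pi.neg_apply, ← hD]
    clear hdu hdv hdx hdy hden hr hr2 hG
    field_simp
    rw [hD]
    linear_combination (-k ^ 2 * ε * s) * hCS
  · simp only [hx, hy]
    linear_combination (a * ε * (ε - Real.cosh (G t))) * hcs - a * hB2
  · simp only [hu, hv, ← hD]
    clear hdu hdv hdx hdy hden hr hr2 hG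
    field_simp
    rw [hD]
    linear_combination k ^ 2 * ((B ^ 2 * Real.cosh (G t) ^ 2 + Real.sinh (G t) ^ 2) * hcs
      + Real.cosh (G t) ^ 2 * hB2 - hCS)
  · simp only [hu, hy, ← hD]
    clear hdu hdv hdx hdy hden hr hr2 hG
    field_simp
    rw [hD]
    linear_combination (k * s * Real.cosh (G t)) * hB2
  · simp only [hv, hx, ← hD]
    clear hdu hdv hdx hdy hden hr hr2 hG
    field_simp
    rw [hD]
    linear_combination (-k * c * Real.cosh (G t)) * hB2

/-- Two points on a Kepler hyperbola with negative angular momentum, in the right order, are joined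
by a solution of the Kepler problem. -/
theorem exists_kepler_arc {μ H A₁ A₂ l x₀ y₀ x₁ y₁ : ℝ} (hμ : 0 < μ) (hH : 0 < H) (hl : 0 < l)
    (hA : μ * (A₁ ^ 2 + A₂ ^ 2 - 1) = 2 * l * H)
    (h₀ : √(x₀ ^ 2 + y₀ ^ 2) + (A₁ * x₀ + A₂ * y₀) = l)
    (h₁ : √(x₁ ^ 2 + y₁ ^ 2) + (A₁ * x₁ + A₂ * y₁) = l)
    (hlt : A₁ * y₁ - A₂ * x₁ < A₁ * y₀ - A₂ * x₀) :
    ∃ (T : ℝ) (x y u v : ℝ → ℝ), 0 < T ∧ (x 0 = x₀ ∧ y 0 = y₀ ∧ x T = x₁ ∧ y T = y₁) ∧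
      ∀ t, 0 < x t ^ 2 + y t ^ 2 ∧
        HasDerivAt x (u t) t ∧ HasDerivAt y (v t) t ∧
        HasDerivAt u (-(μ / √(x t ^ 2 + y t ^ 2) ^ 3) * x t) t ∧
        HasDerivAt v (-(μ / √(x t ^ 2 + y t ^ 2) ^ 3) * y t) t ∧
        √(x t ^ 2 + y t ^ 2) + (A₁ * x t + A₂ * y t) = l ∧
        u t ^ 2 + v t ^ 2 = 2 * (H + μ / √(x t ^ 2 + y t ^ 2)) ∧
        u t = √(μ / l) * (A₂ + y t / √(x t ^ 2 + y t ^ 2)) ∧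
        v t = -(√(μ / l) * (A₁ + x t / √(x t ^ 2 + y t ^ 2))) := by
  have hAA : 1 < A₁ ^ 2 + A₂ ^ 2 := by
    have : 0 < μ * (A₁ ^ 2 + A₂ ^ 2 - 1) := hA ▸ by positivity
    linarith [pos_of_mul_pos_right this hμ.le]
  set ε := √(A₁ ^ 2 + A₂ ^ 2) with hεdef
  have hε2 : ε ^ 2 = A₁ ^ 2 + A₂ ^ 2 := Real.sq_sqrt (by positivity)
  have hε : 1 < ε := by rw [hεdef]; exact Real.lt_sqrt_of_sq_lt (by simpa using hAA)
  have hε0 : ε ≠ 0 := by positivity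
  set B := √(ε ^ 2 - 1) with hBdef
  have hB2 : B ^ 2 = ε ^ 2 - 1 := Real.sq_sqrt (by nlinarith)
  have hB : 0 < B := Real.sqrt_pos.2 (by nlinarith)
  obtain ⟨c, hc⟩ : ∃ c, c = A₁ / ε := ⟨_, rfl⟩
  obtain ⟨s, hs⟩ : ∃ s, s = A₂ / ε := ⟨_, rfl⟩
  have hA1 : A₁ = ε * c := by rw [hc]; field_simp
  have hA2 : A₂ = ε * s := by rw [hs]; field_simp
  have hcs : c ^ 2 + s ^ 2 = 1 := by
    rw [hc, hs, div_pow, div_pow, ← add_div, ← hε2]; field_simp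
  set a := l / B ^ 2 with hadef
  have ha : 0 < a := by positivity
  have haB : a * B ^ 2 = l := by rw [hadef]; field_simp
  -- `a` is the real semi-axis and `k` the speed at infinity: `k² = μ / a = 2H`.
  set k := √(μ / l) * B with hkdef
  have hk : 0 < k := by positivity
  have hk2 : k ^ 2 = μ / a := by
    rw [hkdef, mul_pow, Real.sq_sqrt (by positivity), hadef]; field_simp
  have key : ∀ p q : ℝ, √(p ^ 2 + q ^ 2) + (A₁ * p + A₂ * q) = l →
      ∃ F, Real.sinh F = -(c * q - s * p) / (a * B) ∧
        p = a * ((ε - Real.cosh F) * c + B * Real.sinh F * s) ∧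
        q = a * ((ε - Real.cosh F) * s - B * Real.sinh F * c) := by
    intro p q hpq
    refine ⟨Real.arsinh (-(c * q - s * p) / (a * B)), Real.sinh_arsinh _, ?_⟩
    set S := -(c * q - s * p) / (a * B) with hS
    have hSβ : c * q - s * p = -(a * B * S) := by rw [hS]; field_simp
    have hn : (c * p + s * q) ^ 2 + (c * q - s * p) ^ 2 = p ^ 2 + q ^ 2 := by
      linear_combination (p ^ 2 + q ^ 2) * hcs
    have hα := conic_axial_eq (α := c * p + s * q) hε hl hB hB2 haB
      (by rw [hn, ← hpq, hA1, hA2]; ring) hSβ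
    rw [Real.cosh_arsinh, Real.sinh_arsinh]
    constructor
    · linear_combination (-p) * hcs + c * hα - s * hSβ
    · linear_combination (-q) * hcs + s * hα + c * hSβ
  obtain ⟨F₀, hS₀, hx₀, hy₀⟩ := key x₀ y₀ h₀
  obtain ⟨F₁, hS₁, hx₁, hy₁⟩ := key x₁ y₁ h₁
  -- `sinh F` is a negative multiple of the coordinate transversal to `A`, so `hlt` says that the
  -- second point comes later.
  have hF : F₀ < F₁ := by
    rw [← Real.sinh_lt_sinh, hS₀, hS₁]
    refine div_lt_div_of_pos_right ?_ (by positivity)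
    rw [hA1, hA2] at hlt
    have : ε * (c * y₁ - s * x₁) < ε * (c * y₀ - s * x₀) := by linarith
    linarith [lt_of_mul_lt_mul_left this (by positivity)]
  obtain ⟨T, G, hT, hG0, hGT, hG⟩ := exists_hyperbolic_anomaly hε (div_pos hk ha) hF
  have hμ' : k ^ 2 * a = μ := by rw [hk2]; field_simp
  have hH' : k ^ 2 = 2 * H := by
    have : μ * (ε ^ 2 - 1) = 2 * l * H := by rw [hε2]; exact hA
    rw [← hB2, ← hμ', ← haB] at this
    have h2 : (a * B ^ 2) * k ^ 2 = (a * B ^ 2) * (2 * H) := by linarith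
    exact mul_left_cancel₀ (by positivity) h2
  have hkB : k / B = √(μ / l) := by rw [hkdef]; field_simp
  have hsol := kepler_hyperbola_solution hε ha hB hB2 hcs hG rfl rfl rfl rfl
  refine ⟨T, fun t => a * ((ε - Real.cosh (G t)) * c + B * Real.sinh (G t) * s),
    fun t => a * ((ε - Real.cosh (G t)) * s - B * Real.sinh (G t) * c),
    fun t => k * (-Real.sinh (G t) * c + B * Real.cosh (G t) * s) / (ε * Real.cosh (G t) - 1),
    fun t => k * (-Real.sinh (G t) * s - B * Real.cosh (G t) * c) / (ε * Real.cosh (G t) - 1), hT, ⟨?_, ?_, ?_, ?_⟩, fun t => ?_⟩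
  rotate_left 4
  · have := hsol t
    rw [hμ', hkB, haB, ← hA1, ← hA2, hH', ← mul_add] at this
    exact this
  · simp only [hG0]; exact hx₀.symm
  · simp only [hG0]; exact hy₀.symm
  · simp only [hGT]; exact hx₁.symm
  · simp only [hGT]; exact hy₁.symm

/-! ### Plane vectors, and Kepler arcs inside the ellipse -/

theorem hasDerivAt_plane {x y : ℝ → ℝ} {x' y' t : ℝ} (hx : HasDerivAt x x' t)
    (hy : HasDerivAt y y' t) : HasDerivAt (fun t => (!₂[x t, y t] : Plane)) !₂[x', y'] t := by
  have h : HasDerivAt (fun t => ![x t, y t]) ![x', y'] t := by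
    rw [hasDerivAt_pi]
    intro i
    fin_cases i
    · exact hx
    · exact hy
  exact (PiLp.hasFDerivAt_toLp (𝕜 := ℝ) 2 ![x t, y t]).comp_hasDerivAt t h

theorem norm_plane (x y : ℝ) : ‖(!₂[x, y] : Plane)‖ = √(x ^ 2 + y ^ 2) := by
  simp [EuclideanSpace.norm_eq, Fin.sum_univ_two]

theorem exists_angle_cos_sin {c s : ℝ} (h : c ^ 2 + s ^ 2 = 1) :
    ∃ ξ : Real.Angle, ξ.cos = c ∧ ξ.sin = s := by
  have hn : ‖(⟨c, s⟩ : ℂ)‖ = 1 := by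
    rw [Complex.norm_def, Complex.normSq_mk, ← sq, ← sq, h, Real.sqrt_one]
  have h0 : (⟨c, s⟩ : ℂ) ≠ 0 := by
    rw [← norm_ne_zero_iff, hn]; exact one_ne_zero
  refine ⟨((Complex.arg ⟨c, s⟩ : ℝ) : Real.Angle), ?_, ?_⟩
  · rw [Real.Angle.cos_coe, Complex.cos_arg h0, hn, div_one]
  · rw [Real.Angle.sin_coe, Complex.sin_arg, hn, div_one]

/-- Along a Kepler orbit of positive energy the quadratic form of an ellipse with `b² > 1/2` is
strictly convex in time, so that an arc with end points on the ellipse runs inside of it and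
crosses it transversally. -/
theorem kepler_arc_inside_ellipse {b μ H T : ℝ} {x y u v : ℝ → ℝ} (hb1 : b ^ 2 ≤ 1)
    (hb2 : 1 / 2 < b ^ 2) (hμ : 0 < μ) (hH : 0 < H) (hT : 0 < T)
    (hr : ∀ t, 0 < x t ^ 2 + y t ^ 2)
    (hx : ∀ t, HasDerivAt x (u t) t) (hy : ∀ t, HasDerivAt y (v t) t)
    (hu : ∀ t, HasDerivAt u (-(μ / √(x t ^ 2 + y t ^ 2) ^ 3) * x t) t)
    (hv : ∀ t, HasDerivAt v (-(μ / √(x t ^ 2 + y t ^ 2) ^ 3) * y t) t)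
    (hen : ∀ t, u t ^ 2 + v t ^ 2 = 2 * (H + μ / √(x t ^ 2 + y t ^ 2)))
    (h0 : x 0 ^ 2 + y 0 ^ 2 / b ^ 2 = 1) (h1 : x T ^ 2 + y T ^ 2 / b ^ 2 = 1) :
    (∀ t ∈ Set.Ioo 0 T, x t ^ 2 + y t ^ 2 / b ^ 2 < 1) ∧
      x 0 * u 0 + y 0 * v 0 / b ^ 2 < 0 ∧ 0 < x T * u T + y T * v T / b ^ 2 := by
  set q : ℝ → ℝ := fun t => x t ^ 2 + y t ^ 2 / b ^ 2 with hq
  set g : ℝ → ℝ := fun t => 2 * (x t * u t + y t * v t / b ^ 2) with hg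
  have hb0 : 0 < b ^ 2 := by linarith
  have hdq : ∀ t, HasDerivAt q (g t) t := fun t => by
    refine (((hx t).pow 2).add (((hy t).pow 2).div_const (b ^ 2))).congr_deriv ?_
    simp only [hg]; ring
  have hdg : ∀ t, HasDerivAt g (2 * (u t ^ 2 + v t ^ 2 / b ^ 2
      - μ / √(x t ^ 2 + y t ^ 2) ^ 3 * q t)) t := fun t => by
    refine ((((hx t).mul (hu t)).add
      (((hy t).mul (hv t)).div_const (b ^ 2))).const_mul 2).congr_deriv ?_
    simp only [hq]; ring
  have hpos : ∀ t, 0 < 2 * (u t ^ 2 + v t ^ 2 / b ^ 2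
      - μ / √(x t ^ 2 + y t ^ 2) ^ 3 * q t) := fun t => by
    have hrt := Real.sqrt_pos.2 (hr t)
    have hr2 := Real.sq_sqrt (hr t).le
    have hent := hen t
    -- Here `b² > 1/2` enters. It bounds the attractive term by `2μ/r`, while energy gives `u² + v²
    -- = 2H + 2μ/r`, so `q'' ≥ 4H > 0`.
    have hqb : q t ≤ 2 * √(x t ^ 2 + y t ^ 2) ^ 2 := by
      rw [hr2]
      have : y t ^ 2 / b ^ 2 ≤ 2 * y t ^ 2 := by
        rw [div_le_iff₀ hb0]; nlinarith [sq_nonneg (y t)]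
      simp only [hq]; nlinarith [sq_nonneg (x t)]
    have hvb : v t ^ 2 ≤ v t ^ 2 / b ^ 2 := by
      rw [le_div_iff₀ hb0]; nlinarith [sq_nonneg (v t)]
    set r := √(x t ^ 2 + y t ^ 2)
    have h3 : μ / r ^ 3 * q t ≤ μ / r ^ 3 * (2 * r ^ 2) := by gcongr
    have h4 : μ / r ^ 3 * (2 * r ^ 2) = 2 * (μ / r) := by field_simp
    linarith
  have hmono : StrictMono g := strictMono_of_hasDerivAt_pos hdg hpos
  have hcont : Continuous q := continuous_iff_continuousAt.2 fun t => (hdq t).continuousAt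
  have hconv : StrictConvexOn ℝ Set.univ q := by
    refine StrictMono.strictConvexOn_univ_of_deriv hcont ?_
    rwa [show deriv q = g from funext fun t => (hdq t).deriv]
  -- By Rolle the increasing derivative `g` vanishes at an interior time, which gives its strict
  -- signs at the two ends.
  obtain ⟨τ, hτ, hgτ⟩ := exists_hasDerivAt_eq_zero hT hcont.continuousOn (h0.trans h1.symm)
    fun t _ => hdq t
  refine ⟨fun t ht => ?_, ?_, ?_⟩
  · have := hconv.lt_on_openSegment (Set.mem_univ 0) (Set.mem_univ T) hT.ne
      (by rwa [openSegment_eq_Ioo hT])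
    rwa [show q 0 = 1 from h0, show q T = 1 from h1, max_self] at this
  · have := hmono hτ.1
    rw [hgτ] at this; simp only [hg] at this; linarith
  · have := hmono hτ.2
    rw [hgτ] at this; simp only [hg] at this; linarith

/-! ### Velocities at the interface and outer brake arcs -/

theorem semiMinor_sq {e : ℝ} (he : e ^ 2 ≤ 1) : semiMinor e ^ 2 = 1 - e ^ 2 :=
  Real.sq_sqrt (by linarith)

theorem semiMinor_pos {e : ℝ} (he : e ^ 2 < 1) : 0 < semiMinor e :=
  Real.sqrt_pos.2 (by linarith)

theorem bdrySpeed_sq (e : ℝ) (ξ : Real.Angle) :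
    bdrySpeed e ξ ^ 2 = ξ.sin ^ 2 + semiMinor e ^ 2 * ξ.cos ^ 2 :=
  Real.sq_sqrt (by positivity)

theorem bdrySpeed_pos {e : ℝ} (he : e ^ 2 < 1) (ξ : Real.Angle) : 0 < bdrySpeed e ξ := by
  have hb := semiMinor_pos he
  refine Real.sqrt_pos.2 ?_
  have := ξ.cos_sq_add_sin_sq
  by_cases h : ξ.cos = 0
  · rw [h] at this ⊢; nlinarith
  · positivity

theorem entryVelocity_eq_neg_exitVelocity (e V : ℝ) (ξ : Real.Angle) (α : ℝ) :
    entryVelocity e V ξ α = -exitVelocity e V ξ (-α) := by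
  rw [entryVelocity, exitVelocity, Real.cos_neg, Real.sin_neg]
  module

/-- A velocity with the right modulus that points out of the domain is an exit velocity. -/
theorem exists_exitVelocity_eq {e V p q : ℝ} {ξ : Real.Angle} (he : e ^ 2 < 1) (hV : 0 < V)
    (hpq : p ^ 2 + q ^ 2 = 2 * V) (hn : 0 < semiMinor e * ξ.cos * p + ξ.sin * q) :
    ∃ α ∈ angleRange, exitVelocity e V ξ α = !₂[p, q] ∧
      bdrySpeed e ξ * (√(2 * V) * Real.sin α) = -ξ.sin * p + semiMinor e * ξ.cos * q := by
  have hS := bdrySpeed_pos he ξ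
  have hS2 := bdrySpeed_sq e ξ
  set S := bdrySpeed e ξ
  set b := semiMinor e
  set c := ξ.cos
  set s := ξ.sin
  have hR : 0 < √(2 * V) := by positivity
  have hR2 : √(2 * V) ^ 2 = 2 * V := Real.sq_sqrt (by positivity)
  set R := √(2 * V) with hRdef
  obtain ⟨τ, hτ⟩ : ∃ τ, τ = (-s * p + b * c * q) / (S * R) := ⟨_, rfl⟩
  obtain ⟨ν, hν⟩ : ∃ ν, ν = (b * c * p + s * q) / (S * R) := ⟨_, rfl⟩
  have hν0 : 0 < ν := by rw [hν]; positivity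
  have hsum : τ ^ 2 + ν ^ 2 = 1 := by
    rw [hτ, hν, div_pow, div_pow, ← add_div, div_eq_one_iff_eq (by positivity), mul_pow, hR2, hS2]
    linear_combination (s ^ 2 + b ^ 2 * c ^ 2) * hpq
  have hτ1 : -1 < τ := by nlinarith
  have hτ2 : τ < 1 := by nlinarith
  have hcos : Real.cos (Real.arcsin τ) = ν := by
    rw [Real.cos_arcsin, ← hsum, add_sub_cancel_left, Real.sqrt_sq hν0.le]
  have hsin : Real.sin (Real.arcsin τ) = τ := Real.sin_arcsin hτ1.le hτ2.le
  refine ⟨Real.arcsin τ, ⟨Real.neg_pi_div_two_lt_arcsin.2 hτ1, Real.arcsin_lt_pi_div_two.2 hτ2⟩,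
    ?_, ?_⟩
  · rw [exitVelocity, hcos, hsin]
    have h0 : R * (ν * (S⁻¹ * (b * c)) + τ * (S⁻¹ * (-s))) = p := by
      rw [hτ, hν]; field_simp; rw [hS2]; ring
    have h1 : R * (ν * (S⁻¹ * s) + τ * (S⁻¹ * (b * c))) = q := by
      rw [hτ, hν]; field_simp; rw [hS2]; ring
    rw [← hRdef]
    ext i
    fin_cases i
    · exact h0
    · exact h1
  · rw [hsin, hτ]; field_simp

theorem exists_entryVelocity_eq {e V p q : ℝ} {ξ : Real.Angle} (he : e ^ 2 < 1) (hV : 0 < V)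
    (hpq : p ^ 2 + q ^ 2 = 2 * V) (hn : semiMinor e * ξ.cos * p + ξ.sin * q < 0) :
    ∃ α ∈ angleRange, entryVelocity e V ξ α = !₂[p, q] ∧
      bdrySpeed e ξ * (√(2 * V) * Real.sin α) = -ξ.sin * p + semiMinor e * ξ.cos * q := by
  obtain ⟨α, hα, h1, h2⟩ := exists_exitVelocity_eq (p := -p) (q := -q) (ξ := ξ) he hV
    (by rw [neg_sq, neg_sq, hpq]) (by linarith)
  refine ⟨-α, ⟨by linarith [hα.2], by linarith [hα.1]⟩, ?_, ?_⟩
  · rw [entryVelocity_eq_neg_exitVelocity, neg_neg, h1]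
    ext i; fin_cases i <;> simp
  · rw [Real.sin_neg]; linarith

theorem norm_bdry_sq {e : ℝ} (he : e ^ 2 ≤ 1) (ξ : Real.Angle) :
    ‖bdry e ξ‖ ^ 2 = 1 - e ^ 2 * ξ.sin ^ 2 := by
  rw [bdry, norm_plane, Real.sq_sqrt (by positivity), mul_pow, semiMinor_sq he]
  linear_combination ξ.cos_sq_add_sin_sq

theorem bdry_ne_zero {e : ℝ} (he : e ^ 2 < 1) (ξ : Real.Angle) : bdry e ξ ≠ 0 := by
  rw [← norm_ne_zero_iff]
  intro h
  have := norm_bdry_sq he.le ξ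
  rw [h] at this
  nlinarith [ξ.cos_sq_add_sin_sq, sq_nonneg ξ.cos, sq_nonneg ξ.sin, sq_nonneg e]

theorem outerPot_bdry_pos {E ω e : ℝ} (he : e ^ 2 < 1) (hE : ω ^ 2 / 2 < E) (ξ : Real.Angle) :
    0 < outerPot E ω (bdry e ξ) := by
  rw [outerPot, norm_bdry_sq he.le]
  nlinarith [mul_nonneg (sq_nonneg ω) (mul_nonneg (sq_nonneg e) (sq_nonneg ξ.sin))]

/-- The exit velocity in the radial direction. -/
theorem exists_radial_exitVelocity {E ω e : ℝ} (he : e ^ 2 < 1) (hE : ω ^ 2 / 2 < E)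
    (ξ : Real.Angle) : ∃ α ∈ angleRange,
      exitVelocity e (outerPot E ω (bdry e ξ)) ξ α
        = (√(2 * outerPot E ω (bdry e ξ)) / ‖bdry e ξ‖) • bdry e ξ ∧
      bdrySpeed e ξ * (√(2 * outerPot E ω (bdry e ξ)) * Real.sin α)
        = -(√(2 * outerPot E ω (bdry e ξ)) / ‖bdry e ξ‖ * (e ^ 2 * ξ.sin * ξ.cos)) := by
  have hV := outerPot_bdry_pos he hE ξ
  have hr : 0 < ‖bdry e ξ‖ := norm_pos_iff.2 (bdry_ne_zero he ξ)
  have hr2 := norm_bdry_sq he.le ξ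
  have hb := semiMinor_pos he
  have hb2 := semiMinor_sq he.le
  have hcs := ξ.cos_sq_add_sin_sq
  set V := outerPot E ω (bdry e ξ)
  have hR2 : √(2 * V) ^ 2 = 2 * V := Real.sq_sqrt (by positivity)
  have hR : 0 < √(2 * V) := by positivity
  obtain ⟨k, hk⟩ : ∃ k, k = √(2 * V) / ‖bdry e ξ‖ := ⟨_, rfl⟩
  have hk0 : 0 < k := hk ▸ by positivity
  have hkr : k * ‖bdry e ξ‖ = √(2 * V) := by rw [hk]; field_simp
  obtain ⟨α, hα, h1, h2⟩ := exists_exitVelocity_eq (p := k * ξ.cos)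
    (q := k * (semiMinor e * ξ.sin)) (ξ := ξ) he hV
    (by rw [← hR2, ← hkr, mul_pow k ‖_‖, hr2, mul_pow, mul_pow, mul_pow, hb2]
        linear_combination k ^ 2 * hcs)
    (by have : semiMinor e * ξ.cos * (k * ξ.cos) + ξ.sin * (k * (semiMinor e * ξ.sin))
          = k * semiMinor e := by linear_combination k * semiMinor e * hcs
        rw [this]; positivity)
  refine ⟨α, hα, ?_, ?_⟩
  · rw [h1, ← hk, bdry]
    ext i; fin_cases i <;> simp
  · rw [h2, ← hk]; linear_combination k * ξ.sin * ξ.cos * hb2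

theorem closure_domain_subset (e : ℝ) :
    closure (domain e) ⊆ {z | z 0 ^ 2 + z 1 ^ 2 / semiMinor e ^ 2 ≤ 1} := by
  refine closure_minimal (fun z hz => (show _ < (1 : ℝ) from hz).le) (isClosed_le ?_ continuous_const)
  fun_prop

/-- The homothetic brake arc of the outer harmonic oscillator. -/
theorem exists_brake_outerArc {E ω e α : ℝ} {ξ : Real.Angle} (he : e ^ 2 < 1) (hω : 0 < ω)
    (hE : ω ^ 2 / 2 < E)
    (hα : exitVelocity e (outerPot E ω (bdry e ξ)) ξ α
        = (√(2 * outerPot E ω (bdry e ξ)) / ‖bdry e ξ‖) • bdry e ξ) :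
    ∃ (T : ℝ) (z w : ℝ → Plane), IsOuterArc E ω e ξ α ξ (-α) T z w ∧
      (∀ t ∈ Set.Icc 0 T, ∃ r : ℝ, 0 < r ∧ z t = r • bdry e ξ) ∧ ∃ t ∈ Set.Ioo 0 T, w t = 0 := by
  have hV := outerPot_bdry_pos he hE ξ
  have hr : 0 < ‖bdry e ξ‖ := norm_pos_iff.2 (bdry_ne_zero he ξ)
  obtain ⟨k, hk⟩ : ∃ k, k = √(2 * outerPot E ω (bdry e ξ)) / ‖bdry e ξ‖ := ⟨_, rfl⟩
  have hk0 : 0 < k := hk ▸ by positivity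
  rw [← hk] at hα
  -- The arc is `cos (ω t - φ) / cos φ` times the starting point. Its initial velocity factor is `ω
  -- tan φ`, which has to be `k`; it stops at `φ / ω` and is back at `2 φ / ω`.
  set φ := Real.arctan (k / ω) with hφ
  have hφ0 : 0 < φ := Real.arctan_pos.2 (by positivity)
  have hφ1 : φ < Real.pi / 2 := Real.arctan_lt_pi_div_two _
  have hcos : 0 < Real.cos φ := Real.cos_arctan_pos _
  have htan : Real.sin φ / Real.cos φ = k / ω := by
    rw [← Real.tan_eq_sin_div_cos, Real.tan_arctan]
  have hangle : ∀ t, HasDerivAt (fun t => ω * t - φ) ω t := fun t => by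
    simpa using ((hasDerivAt_id t).const_mul ω).sub_const φ
  have hT : ω * (2 * φ / ω) - φ = φ := by field_simp; ring
  have hcosle : ∀ t ∈ Set.Icc 0 (2 * φ / ω), Real.cos φ ≤ Real.cos (ω * t - φ) := by
    intro t ht
    have h2 : t * ω ≤ 2 * φ := (le_div_iff₀ hω).1 ht.2
    have h1 : 0 ≤ t * ω := mul_nonneg ht.1 hω.le
    rw [← Real.cos_abs (ω * t - φ)]
    exact Real.cos_le_cos_of_nonneg_of_le_pi (abs_nonneg _) (by linarith)
      (abs_le.2 ⟨by linarith, by linarith⟩)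
  have hcoslt : ∀ t ∈ Set.Ioo 0 (2 * φ / ω), Real.cos φ < Real.cos (ω * t - φ) := by
    intro t ht
    have h2 : t * ω < 2 * φ := (lt_div_iff₀ hω).1 ht.2
    have h1 : 0 < t * ω := mul_pos ht.1 hω
    rw [← Real.cos_abs (ω * t - φ)]
    exact Real.cos_lt_cos_of_nonneg_of_le_pi (abs_nonneg _) (by linarith)
      (abs_lt.2 ⟨by linarith, by linarith⟩)
  refine ⟨2 * φ / ω, fun t => (Real.cos (ω * t - φ) / Real.cos φ) • bdry e ξ,
    fun t => (-(ω * Real.sin (ω * t - φ)) / Real.cos φ) • bdry e ξ,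
    ⟨by positivity, ?_, ?_, ?_, ?_, ?_, ?_, ?_⟩, ?_, ?_⟩
  · intro t _
    refine HasDerivAt.hasDerivWithinAt (HasDerivAt.smul_const ?_ _)
    exact ((hangle t).cos.div_const _).congr_deriv (by ring)
  · intro t _
    rw [smul_smul]
    refine HasDerivAt.hasDerivWithinAt (HasDerivAt.smul_const ?_ _)
    exact ((((hangle t).sin.const_mul ω).neg).div_const _).congr_deriv (by ring)
  · simp [Real.cos_neg, hcos.ne']
  · rw [hα]
    congr 1
    rw [mul_zero, zero_sub, Real.sin_neg, mul_neg, neg_neg, mul_div_assoc, htan]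
    field_simp
  · intro t ht hmem
    have h1 := closure_domain_subset e hmem
    have h2 : 1 < Real.cos (ω * t - φ) / Real.cos φ := (one_lt_div hcos).2 (hcoslt t ht)
    set ρ := Real.cos (ω * t - φ) / Real.cos φ
    have hb := semiMinor_pos he
    have h3 : (ρ * ξ.cos) ^ 2 + (ρ * (semiMinor e * ξ.sin)) ^ 2 / semiMinor e ^ 2 = ρ ^ 2 := by
      field_simp
      linear_combination ξ.cos_sq_add_sin_sq
    have h4 : (ρ * ξ.cos) ^ 2 + (ρ * (semiMinor e * ξ.sin)) ^ 2 / semiMinor e ^ 2 ≤ 1 := by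
      simpa [bdry] using h1
    nlinarith
  · simp only [hT, div_self hcos.ne', one_smul]
  · rw [entryVelocity_eq_neg_exitVelocity, neg_neg, hα, ← neg_smul]
    congr 1
    rw [hT, neg_div, mul_div_assoc, htan]
    field_simp
  · intro t ht
    exact ⟨_, div_pos (hcos.trans_le (hcosle t ht)) hcos, rfl⟩
  · refine ⟨φ / ω, ⟨by positivity, ?_⟩, ?_⟩
    · gcongr; linarith
    · have : ω * (φ / ω) - φ = 0 := by field_simp; ring
      simp [this]

/-! ### Brake links and how they close up -/

/-- A Kepler arc on a hyperbola between the points `(c₀, b s₀)` and `(c₁, b s₁)` of the ellipse,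
whose end velocities have the same tangential components as the radial outer velocities. -/
structure IsBrakeLink (E ω h μ e c₀ s₀ c₁ s₁ A₁ A₂ l T : ℝ) (x y u v : ℝ → ℝ) : Prop where
  pos : 0 < T
  start_x : x 0 = c₀
  start_y : y 0 = semiMinor e * s₀
  end_x : x T = c₁
  end_y : y T = semiMinor e * s₁
  radius_pos : ∀ t, 0 < x t ^ 2 + y t ^ 2
  deriv_x : ∀ t, HasDerivAt x (u t) t
  deriv_y : ∀ t, HasDerivAt y (v t) t
  deriv_u : ∀ t, HasDerivAt u (-(μ / √(x t ^ 2 + y t ^ 2) ^ 3) * x t) t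
  deriv_v : ∀ t, HasDerivAt v (-(μ / √(x t ^ 2 + y t ^ 2) ^ 3) * y t) t
  energy : ∀ t, u t ^ 2 + v t ^ 2 = 2 * (E + h + μ / √(x t ^ 2 + y t ^ 2))
  conic : ∀ t, √(x t ^ 2 + y t ^ 2) + (A₁ * x t + A₂ * y t) = l
  eccentricity : 1 < A₁ ^ 2 + A₂ ^ 2
  l_pos : 0 < l
  start_tangent : -s₀ * u 0 + semiMinor e * c₀ * v 0
    = √(2 * (E - ω ^ 2 / 2 * √(c₀ ^ 2 + (semiMinor e * s₀) ^ 2) ^ 2))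
      / √(c₀ ^ 2 + (semiMinor e * s₀) ^ 2) * (e ^ 2 * s₀ * c₀)
  end_tangent : -s₁ * u T + semiMinor e * c₁ * v T
    = -(√(2 * (E - ω ^ 2 / 2 * √(c₁ ^ 2 + (semiMinor e * s₁) ^ 2) ^ 2))
      / √(c₁ ^ 2 + (semiMinor e * s₁) ^ 2) * (e ^ 2 * s₁ * c₁))

/-- The reflections in the coordinate axes act on brake links. -/
theorem IsBrakeLink.reflect {E ω h μ e c₀ s₀ c₁ s₁ A₁ A₂ l T σ τ : ℝ} {x y u v : ℝ → ℝ}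
    (H : IsBrakeLink E ω h μ e c₀ s₀ c₁ s₁ A₁ A₂ l T x y u v) (hσ : σ ^ 2 = 1) (hτ : τ ^ 2 = 1) :
    IsBrakeLink E ω h μ e (σ * c₀) (τ * s₀) (σ * c₁) (τ * s₁) (σ * A₁) (τ * A₂) l T
      (fun t => σ * x t) (fun t => τ * y t) (fun t => σ * u t) (fun t => τ * v t) := by
  have hsq : ∀ p q : ℝ, (σ * p) ^ 2 + (τ * q) ^ 2 = p ^ 2 + q ^ 2 := fun p q => by
    rw [mul_pow, mul_pow, hσ, hτ, one_mul, one_mul]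
  have hsq' : ∀ p q : ℝ, (σ * p) ^ 2 + (semiMinor e * (τ * q)) ^ 2
      = p ^ 2 + (semiMinor e * q) ^ 2 := fun p q => by
    rw [← hsq p (semiMinor e * q)]; ring
  refine ⟨H.pos, ?_, ?_, ?_, ?_, fun t => ?_, fun t => (H.deriv_x t).const_mul σ,
    fun t => (H.deriv_y t).const_mul τ, fun t => ?_, fun t => ?_, fun t => ?_, fun t => ?_, ?_,
    H.l_pos, ?_, ?_⟩
  · rw [H.start_x]
  · simp only [H.start_y]; ring
  · rw [H.end_x]
  · simp only [H.end_y]; ring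
  · rw [hsq]; exact H.radius_pos t
  · rw [hsq]; exact ((H.deriv_u t).const_mul σ).congr_deriv (by ring)
  · rw [hsq]; exact ((H.deriv_v t).const_mul τ).congr_deriv (by ring)
  · rw [hsq, hsq]; exact H.energy t
  · rw [hsq, ← H.conic t]
    linear_combination A₁ * x t * hσ + A₂ * y t * hτ
  · rw [hsq]; exact H.eccentricity
  · rw [hsq']; linear_combination σ * τ * H.start_tangent
  · rw [hsq']; linear_combination σ * τ * H.end_tangent

theorem isInnerArc_of_solution {E h μ e α α' T : ℝ} {ξ ξ' : Real.Angle} {z w : ℝ → Plane}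
    (hT : 0 < T) (hz : ∀ t, HasDerivAt z (w t) t)
    (hw : ∀ t, HasDerivAt w (-(μ / ‖z t‖ ^ 3) • z t) t) (h0 : ∀ t, z t ≠ 0)
    (hz0 : z 0 = bdry e ξ) (hw0 : w 0 = entryVelocity e (innerPot E h μ (bdry e ξ)) ξ α)
    (hin : ∀ t ∈ Set.Ioo 0 T, z t ∈ domain e) (hzT : z T = bdry e ξ')
    (hwT : w T = exitVelocity e (innerPot E h μ (bdry e ξ')) ξ' α') :
    IsInnerArc E h μ e ξ α ξ' α' T z w where
  pos := hT
  cont := (continuous_iff_continuousAt.2 fun t => (hz t).continuousAt).continuousOn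
  deriv_pos t _ _ := (hz t).hasDerivWithinAt
  deriv_vel t _ _ := (hw t).hasDerivWithinAt
  collision t _ h := absurd h (h0 t)
  start_pos := hz0
  start_vel := hw0
  inside := hin
  end_pos := hzT
  end_vel := hwT

/-- The inner arc of the second half of the orbit: time reversal swaps entry and exit and changes
the sign of both angles. -/
theorem isInnerArc_reverse_of_solution {E h μ e α α' T : ℝ} {ξ ξ' : Real.Angle}
    {z w : ℝ → Plane} (hT : 0 < T) (hz : ∀ t, HasDerivAt z (w t) t)
    (hw : ∀ t, HasDerivAt w (-(μ / ‖z t‖ ^ 3) • z t) t) (h0 : ∀ t, z t ≠ 0)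
    (hz0 : z 0 = bdry e ξ) (hw0 : w 0 = entryVelocity e (innerPot E h μ (bdry e ξ)) ξ α)
    (hin : ∀ t ∈ Set.Ioo 0 T, z t ∈ domain e) (hzT : z T = bdry e ξ')
    (hwT : w T = exitVelocity e (innerPot E h μ (bdry e ξ')) ξ' α') :
    IsInnerArc E h μ e ξ' (-α') ξ (-α) T (fun t => z (T - t)) (fun t => -w (T - t)) := by
  refine isInnerArc_of_solution hT (fun t => (hz (T - t)).comp_const_sub T t) (fun t => ?_)
    (fun t => h0 _) ?_ ?_ (fun t ht => hin _ ⟨by linarith [ht.2], by linarith [ht.1]⟩) ?_ ?_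
  · have := ((hw (T - t)).comp_const_sub T t).neg
    rwa [neg_neg] at this
  · rw [sub_zero, hzT]
  · rw [sub_zero, hwT, entryVelocity_eq_neg_exitVelocity, neg_neg]
  · rw [sub_self, hz0]
  · rw [sub_self, hw0, entryVelocity_eq_neg_exitVelocity, neg_neg]

/-- `√(2V) sin α` is the tangential velocity component, so Snell's law is its continuity across the
interface. -/
theorem snell_of_tangential {E ω h μ e αE αI : ℝ} {ξ : Real.Angle} (he : e ^ 2 < 1)
    (htan : bdrySpeed e ξ * (√(2 * innerPot E h μ (bdry e ξ)) * Real.sin αI)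
      = bdrySpeed e ξ * (√(2 * outerPot E ω (bdry e ξ)) * Real.sin αE)) :
    Snell E ω h μ e ξ αE αI := by
  have h1 := mul_left_cancel₀ (bdrySpeed_pos he ξ).ne' htan
  rw [Real.sqrt_mul zero_le_two, Real.sqrt_mul zero_le_two, mul_assoc, mul_assoc] at h1
  exact mul_left_cancel₀ (by positivity) h1

/-- A brake link closes up to a two-periodic brake trajectory. -/
theorem IsBrakeLink.exists_isTwoPeriodicBrake {E ω h μ e A₁ A₂ l T : ℝ} {ξ₀ ξ₁ : Real.Angle}
    {x y u v : ℝ → ℝ} (hω : 0 < ω) (hE : ω ^ 2 / 2 < E) (hh : 0 < h) (hμ : 0 < μ)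
    (he : e ^ 2 < 1 / 2)
    (H : IsBrakeLink E ω h μ e ξ₀.cos ξ₀.sin ξ₁.cos ξ₁.sin A₁ A₂ l T x y u v) (hne : ξ₀ ≠ ξ₁) :
    ∃ α₀ α₁, IsTwoPeriodicBrake E ω h μ e (ξ₀, α₀) (ξ₁, α₁) := by
  have he1 : e ^ 2 < 1 := by linarith
  have hE0 : 0 < E := by nlinarith [sq_nonneg ω]
  have hb := semiMinor_pos he1
  have hb2 := semiMinor_sq he1.le
  have hon : ∀ ξ : Real.Angle, ξ.cos ^ 2 + (semiMinor e * ξ.sin) ^ 2 / semiMinor e ^ 2 = 1 :=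
    fun ξ => by rw [mul_pow, mul_div_cancel_left₀ _ (by positivity), ξ.cos_sq_add_sin_sq]
  obtain ⟨hin, hneg, hpos⟩ := kepler_arc_inside_ellipse (b := semiMinor e) (by nlinarith)
    (by linarith) hμ (by positivity : 0 < E + h) H.pos H.radius_pos H.deriv_x H.deriv_y H.deriv_u
    H.deriv_v H.energy (by rw [H.start_x, H.start_y, hon]) (by rw [H.end_x, H.end_y, hon])
  have hVI : ∀ ξ : Real.Angle, 0 < innerPot E h μ (bdry e ξ) := fun ξ => by
    rw [innerPot]; positivity
  have hinner : ∀ ξ : Real.Angle, innerPot E h μ (bdry e ξ)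
      = E + h + μ / √(ξ.cos ^ 2 + (semiMinor e * ξ.sin) ^ 2) := fun ξ => by
    rw [innerPot, bdry, norm_plane]
  have houter : ∀ ξ : Real.Angle, outerPot E ω (bdry e ξ)
      = E - ω ^ 2 / 2 * √(ξ.cos ^ 2 + (semiMinor e * ξ.sin) ^ 2) ^ 2 := fun ξ => by
    rw [outerPot, bdry, norm_plane]
  have hnorm : ∀ ξ : Real.Angle, ‖bdry e ξ‖ = √(ξ.cos ^ 2 + (semiMinor e * ξ.sin) ^ 2) :=
    fun ξ => by rw [bdry, norm_plane]
  obtain ⟨αI, hαI, hentry, htanI⟩ := exists_entryVelocity_eq (p := u 0) (q := v 0) (ξ := ξ₀) he1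
    (hVI ξ₀) (by rw [H.energy, hinner, H.start_x, H.start_y]) (by
      rw [H.start_x, H.start_y] at hneg
      have : semiMinor e * ξ₀.cos * u 0 + ξ₀.sin * v 0 = semiMinor e *
        (ξ₀.cos * u 0 + semiMinor e * ξ₀.sin * v 0 / semiMinor e ^ 2) := by field_simp
      rw [this]; exact mul_neg_of_pos_of_neg hb hneg)
  obtain ⟨αF, hαF, hexit, htanF⟩ := exists_exitVelocity_eq (p := u T) (q := v T) (ξ := ξ₁) he1
    (hVI ξ₁) (by rw [H.energy, hinner, H.end_x, H.end_y]) (by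
      rw [H.end_x, H.end_y] at hpos
      have : semiMinor e * ξ₁.cos * u T + ξ₁.sin * v T = semiMinor e *
        (ξ₁.cos * u T + semiMinor e * ξ₁.sin * v T / semiMinor e ^ 2) := by field_simp
      rw [this]; exact mul_pos hb hpos)
  obtain ⟨α₀, hα₀, hrad₀, htan₀⟩ := exists_radial_exitVelocity he1 hE ξ₀
  obtain ⟨α₁, hα₁, hrad₁, htan₁⟩ := exists_radial_exitVelocity he1 hE ξ₁
  obtain ⟨T₀, z₀, w₀, harc₀, hray₀, hbrake₀⟩ := exists_brake_outerArc he1 hω hE hrad₀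
  obtain ⟨T₁, z₁, w₁, harc₁, hray₁, hbrake₁⟩ := exists_brake_outerArc he1 hω hE hrad₁
  have hneg_mem : ∀ α ∈ angleRange, -α ∈ angleRange := fun α hα =>
    ⟨by linarith [hα.2], by linarith [hα.1]⟩
  have hsnell₀ : Snell E ω h μ e ξ₀ (-α₀) αI := snell_of_tangential he1 (by
    rw [htanI, H.start_tangent, Real.sin_neg, ← houter, ← hnorm]; linarith)
  have hsnell₁ : Snell E ω h μ e ξ₁ α₁ αF := snell_of_tangential he1 (by
    rw [htanF, H.end_tangent, htan₁, ← houter, ← hnorm])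
  have hsnell₀' : Snell E ω h μ e ξ₀ α₀ (-αI) := by
    unfold Snell at hsnell₀ ⊢; rw [Real.sin_neg] at hsnell₀ ⊢; linarith
  have hsnell₁' : Snell E ω h μ e ξ₁ (-α₁) (-αF) := by
    unfold Snell at hsnell₁ ⊢; rw [Real.sin_neg, Real.sin_neg]; linarith
  set z : ℝ → Plane := fun t => !₂[x t, y t] with hzdef
  set w : ℝ → Plane := fun t => !₂[u t, v t] with hwdef
  have hz : ∀ t, HasDerivAt z (w t) t := fun t => hasDerivAt_plane (H.deriv_x t) (H.deriv_y t)
  have hw : ∀ t, HasDerivAt w (-(μ / ‖z t‖ ^ 3) • z t) t := fun t => by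
    refine (hasDerivAt_plane (H.deriv_u t) (H.deriv_v t)).congr_deriv ?_
    simp only [hzdef, norm_plane]
    ext i; fin_cases i <;> simp
  have h0 : ∀ t, z t ≠ 0 := fun t => by
    rw [← norm_ne_zero_iff, hzdef, norm_plane]
    exact (Real.sqrt_pos.2 (H.radius_pos t)).ne'
  have hz0 : z 0 = bdry e ξ₀ := by simp only [hzdef, H.start_x, H.start_y, bdry]
  have hzT : z T = bdry e ξ₁ := by simp only [hzdef, H.end_x, H.end_y, bdry]
  have hdom : ∀ t ∈ Set.Ioo 0 T, z t ∈ domain e := hin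
  have harc := isInnerArc_of_solution H.pos hz hw h0 hz0 hentry.symm hdom hzT hexit.symm
  have harc' := isInnerArc_reverse_of_solution H.pos hz hw h0 hz0 hentry.symm hdom hzT hexit.symm
  have hA : 1 < ‖(!₂[A₁, A₂] : Plane)‖ := by
    rw [norm_plane]; exact Real.lt_sqrt_of_sq_lt (by simpa using H.eccentricity)
  have hconic : ∀ t, ‖z t‖ + inner ℝ (!₂[A₁, A₂] : Plane) (z t) = l := fun t => by
    rw [← H.conic t, hzdef, norm_plane]
    simp [PiLp.inner_apply, Fin.sum_univ_two]
    ring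
  let c₁ : Concatenation E ω h μ e (ξ₀, α₀) (ξ₁, α₁) :=
    ⟨ξ₀, -α₀, αI, αF, T₀, T, z₀, w₀, z, w, hα₀, hneg_mem _ hα₀, hαI, hαF, hα₁, harc₀, hsnell₀,
      harc, hsnell₁⟩
  let c₂ : Concatenation E ω h μ e (ξ₁, α₁) (ξ₀, α₀) :=
    ⟨ξ₁, -α₁, -αF, -αI, T₁, T, z₁, w₁, _, _, hα₁, hneg_mem _ hα₁, hneg_mem _ hαF, hneg_mem _ hαI,
      hα₀, harc₁, hsnell₁', harc', hsnell₀'⟩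
  exact ⟨α₀, α₁, fun heq => hne (congrArg Prod.fst heq), ⟨c₁⟩, ⟨c₂⟩,
    ⟨c₁, ⟨hray₀, hbrake₀⟩, !₂[A₁, A₂], l, hA, H.l_pos, fun t _ => hconic t⟩,
    ⟨c₂, ⟨hray₁, hbrake₁⟩, !₂[A₁, A₂], l, hA, H.l_pos, fun t _ => hconic _⟩⟩

/-! ### From the matching equations to a brake link -/

/-- Eliminating `r` through the conic equation leaves only terms carrying a factor `l` or `s * c`.
Both are of order `σ` near the vertices, which is what permits the division by `σ` in
`linkEquations`. -/
theorem tangential_component_conic {e b c s A₁ A₂ l k r : ℝ} (hcs : c ^ 2 + s ^ 2 = 1)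
    (hb : b ^ 2 = 1 - e ^ 2) (hr0 : 0 < r) (hr : r ^ 2 = c ^ 2 + (b * s) ^ 2)
    (hl : r + (A₁ * c + A₂ * (b * s)) = l) :
    -s * (k * (A₂ + b * s / r)) + b * c * -(k * (A₁ + c / r))
      = -(k * (b * l + e ^ 2 * s * c * (-A₁ * (b * s) + A₂ * c)) / r ^ 2) := by
  have hid : r ^ 2 * (b * c * A₁ + s * A₂) + r * b * (c ^ 2 + s ^ 2)
      = b * l + e ^ 2 * s * c * (-A₁ * (b * s) + A₂ * c) := by
    rw [← hl, hr, hcs]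
    linear_combination (b * c * s ^ 2 * A₁ - s * c ^ 2 * A₂) * hb
      + (b * c * A₁ + b ^ 2 * s * A₂) * hcs
  rw [← hid]
  field_simp
  ring

-- Open conditions that hold in the limit: the conic is a hyperbola, the end points are off the
-- axes, each is close to its own vertex, and the arc meets them in the right order.
open Filter Topology in
theorem linkEquations_nondegenerate {e b : ℝ} (he : 0 < e) (hb : 0 < b) :
    ∀ᶠ z in 𝓝 (((0, 0), (-1, -1, b / e ^ 2, 1 / e ^ 2)) : (ℝ × ℝ) × (ℝ × ℝ × ℝ × ℝ)),
      1 < z.2.1 ^ 2 + z.2.2.1 ^ 2 ∧ 0 < z.2.2.2.1 ∧ 0 < z.2.2.2.2 ∧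
      z.1.2 ^ 2 * z.2.2.2.1 ^ 2 < 1 / 4 ∧ z.1.2 ^ 2 * z.2.2.2.2 ^ 2 < 1 / 4 ∧
      -z.2.1 * (b * (z.1.2 * z.2.2.2.1)) + z.2.2.1 * √(1 - z.1.2 ^ 2 * z.2.2.2.1 ^ 2) < 0 ∧
      0 < -z.2.1 * (b * √(1 - z.1.2 ^ 2 * z.2.2.2.2 ^ 2)) + z.2.2.1 * (-(z.1.2 * z.2.2.2.2)) := by
  refine .and ?_ (.and ?_ (.and ?_ (.and ?_ (.and ?_ (.and ?_ ?_)))))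
  · exact continuousAt_const.eventually_lt (by fun_prop) (by norm_num)
  · exact continuousAt_const.eventually_lt (by fun_prop) (by positivity)
  · exact continuousAt_const.eventually_lt (by fun_prop) (by positivity)
  · exact ContinuousAt.eventually_lt (by fun_prop) continuousAt_const (by norm_num)
  · exact ContinuousAt.eventually_lt (by fun_prop) continuousAt_const (by norm_num)
  · exact ContinuousAt.eventually_lt (by fun_prop) continuousAt_const (by norm_num)
  · exact continuousAt_const.eventually_lt (by fun_prop) (by simpa using hb)

/-- A nondegenerate solution of the link equations yields a brake link. -/
theorem exists_isBrakeLink_of_linkEquations {E ω h μ e A₁ A₂ y₀ y₁ σ : ℝ}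
    (he0 : 0 < e) (he : e ^ 2 < 1) (hμ : 0 < μ) (hH : 0 < E + h) (hσ : σ = μ / (2 * (E + h)))
    (heq : linkEquations e (semiMinor e) E ω ((1 / √(2 * (E + h)), σ), (A₁, A₂, y₀, y₁)) = 0)
    (hA : 1 < A₁ ^ 2 + A₂ ^ 2) (hy₀ : σ ^ 2 * y₀ ^ 2 < 1 / 4) (hy₁ : σ ^ 2 * y₁ ^ 2 < 1 / 4)
    (hJ₀ : -A₁ * (semiMinor e * (σ * y₀)) + A₂ * √(1 - σ ^ 2 * y₀ ^ 2) < 0)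
    (hJ₁ : 0 < -A₁ * (semiMinor e * √(1 - σ ^ 2 * y₁ ^ 2)) + A₂ * (-(σ * y₁))) :
    ∃ (l T : ℝ) (x y u v : ℝ → ℝ), IsBrakeLink E ω h μ e (√(1 - σ ^ 2 * y₀ ^ 2)) (σ * y₀)
      (-(σ * y₁)) (√(1 - σ ^ 2 * y₁ ^ 2)) A₁ A₂ l T x y u v := by
  have hb := semiMinor_pos he
  have hb2 := semiMinor_sq he.le
  set b := semiMinor e with hbdef
  have hσ0 : 0 < σ := hσ ▸ by positivity
  simp only [linkEquations, Prod.mk_eq_zero] at heq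
  obtain ⟨e₁, e₂, e₃, e₄⟩ := heq
  have hc₀ : √(1 - σ ^ 2 * y₀ ^ 2) ^ 2 = 1 - σ ^ 2 * y₀ ^ 2 := Real.sq_sqrt (by linarith)
  have hc₁ : √(1 - σ ^ 2 * y₁ ^ 2) ^ 2 = 1 - σ ^ 2 * y₁ ^ 2 := Real.sq_sqrt (by linarith)
  have hc₁pos : 0 < √(1 - σ ^ 2 * y₁ ^ 2) := Real.sqrt_pos.2 (by linarith)
  have hc₀pos : 0 < √(1 - σ ^ 2 * y₀ ^ 2) := Real.sqrt_pos.2 (by linarith)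
  set c₀ := √(1 - σ ^ 2 * y₀ ^ 2)
  set c₁ := √(1 - σ ^ 2 * y₁ ^ 2)
  have hr₀ : 0 < √(c₀ ^ 2 + (b * (σ * y₀)) ^ 2) := Real.sqrt_pos.2 (by positivity)
  have hr₁ : 0 < √((-(σ * y₁)) ^ 2 + (b * c₁) ^ 2) := Real.sqrt_pos.2 (by positivity)
  have hr₀2 : √(c₀ ^ 2 + (b * (σ * y₀)) ^ 2) ^ 2 = c₀ ^ 2 + (b * (σ * y₀)) ^ 2 :=
    Real.sq_sqrt (by positivity)
  have hr₁2 : √((-(σ * y₁)) ^ 2 + (b * c₁) ^ 2) ^ 2 = (-(σ * y₁)) ^ 2 + (b * c₁) ^ 2 :=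
    Real.sq_sqrt (by positivity)
  set lam := A₁ ^ 2 + A₂ ^ 2 - 1 with hlam
  have hlam0 : 0 < lam := by linarith
  have hl : 0 < σ * lam := mul_pos hσ0 hlam0
  -- This undoes the normalisation of the last two link equations; it holds because `σ = μ / (2H)`
  -- and `κ = 1 / √(2H)`.
  have hk : √(μ / (σ * lam)) * (√lam * (1 / √(2 * (E + h)))) = 1 := by
    have : μ / (σ * lam) = 2 * (E + h) / lam := by rw [hσ]; field_simp
    rw [this, Real.sqrt_div (by positivity)]
    have h1 : √lam ≠ 0 := by positivity
    have h2 : √(2 * (E + h)) ≠ 0 := by positivity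
    field_simp
  obtain ⟨T, x, y, u, v, hT, ⟨hx0, hy0, hxT, hyT⟩, hsol⟩ := exists_kepler_arc (H := E + h)
    (A₁ := A₁) (A₂ := A₂) (l := σ * lam) (x₀ := c₀) (y₀ := b * (σ * y₀)) (x₁ := -(σ * y₁))
    (y₁ := b * c₁) hμ hH hl
    (by rw [← hlam, hσ]; field_simp) (by linarith) (by linarith) (by linarith)
  have hu : ∀ t, _ := fun t => (hsol t).2.2.2.2.2.2.2.1
  have hv : ∀ t, _ := fun t => (hsol t).2.2.2.2.2.2.2.2
  refine ⟨σ * lam, T, x, y, u, v, hT, hx0, hy0, hxT, hyT, fun t => (hsol t).1,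
    fun t => (hsol t).2.1, fun t => (hsol t).2.2.1, fun t => (hsol t).2.2.2.1,
    fun t => (hsol t).2.2.2.2.1, fun t => (hsol t).2.2.2.2.2.2.1,
    fun t => (hsol t).2.2.2.2.2.1, hA, hl, ?_, ?_⟩
  · rw [hu, hv, hx0, hy0, ← hbdef, tangential_component_conic (e := e) (l := σ * lam)
      (by rw [hc₀]; ring) hb2 hr₀ hr₀2 (by linarith)]
    set r := √(c₀ ^ 2 + (b * (σ * y₀)) ^ 2)
    have hV : 2 * (E - ω ^ 2 / 2 * r ^ 2) = 2 * E - ω ^ 2 * r ^ 2 := by ring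
    rw [hV]
    set w := √(2 * E - ω ^ 2 * r ^ 2)
    set k := √(μ / (σ * lam))
    have hid : k * (b * (σ * lam) + e ^ 2 * (σ * y₀) * c₀ * (-A₁ * (b * (σ * y₀)) + A₂ * c₀))
        = -(r * w * (e ^ 2 * (σ * y₀) * c₀)) := by
      linear_combination k * σ * e₃ - r * w * (e ^ 2 * (σ * y₀) * c₀) * hk
    rw [hid]
    field_simp
  · rw [hu, hv, hxT, hyT, ← hbdef, tangential_component_conic (e := e) (l := σ * lam)
      (by rw [hc₁]; ring) hb2 hr₁ hr₁2 (by linarith)]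
    set r := √((-(σ * y₁)) ^ 2 + (b * c₁) ^ 2)
    have hV : 2 * (E - ω ^ 2 / 2 * r ^ 2) = 2 * E - ω ^ 2 * r ^ 2 := by ring
    rw [hV]
    set w := √(2 * E - ω ^ 2 * r ^ 2)
    set k := √(μ / (σ * lam))
    have hid : k * (b * (σ * lam)
        + e ^ 2 * c₁ * (-(σ * y₁)) * (-A₁ * (b * c₁) + A₂ * (-(σ * y₁))))
        = r * w * (e ^ 2 * c₁ * (-(σ * y₁))) := by
      linear_combination -k * σ * e₄ + r * w * (e ^ 2 * c₁ * (-(σ * y₁))) * hk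
    rw [hid]
    field_simp

/-! ### Symmetry and the four orbits -/

/-- The reflected images of a brake link off the axes yield four disjoint brake trajectories. -/
theorem IsBrakeLink.exists_four {E ω h μ e c₀ s₀ c₁ s₁ A₁ A₂ l T : ℝ} {x y u v : ℝ → ℝ}
    (hω : 0 < ω) (hE : ω ^ 2 / 2 < E) (hh : 0 < h) (hμ : 0 < μ) (he : e ^ 2 < 1 / 2)
    (H : IsBrakeLink E ω h μ e c₀ s₀ c₁ s₁ A₁ A₂ l T x y u v)
    (h₀ : c₀ ^ 2 + s₀ ^ 2 = 1) (h₁ : c₁ ^ 2 + s₁ ^ 2 = 1) (hc₀ : c₀ ≠ 0) (hs₀ : s₀ ≠ 0)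
    (hc₁ : c₁ ≠ 0) (hs : s₀ ^ 2 < s₁ ^ 2) :
    ∃ P Q : Fin 4 → PhasePoint, (∀ i, IsTwoPeriodicBrake E ω h μ e (P i) (Q i)) ∧
      Pairwise (fun i j => Disjoint ({P i, Q i} : Set PhasePoint) {P j, Q j}) := by
  have hs₁ : s₁ ≠ 0 := by rintro rfl; nlinarith [sq_nonneg s₀]
  obtain ⟨σ, hσ⟩ : ∃ σ : Fin 4 → ℝ, σ = ![1, 1, -1, -1] := ⟨_, rfl⟩
  obtain ⟨τ, hτ⟩ : ∃ τ : Fin 4 → ℝ, τ = ![1, -1, 1, -1] := ⟨_, rfl⟩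
  have hσ2 : ∀ i, σ i ^ 2 = 1 := fun i => by fin_cases i <;> simp [hσ]
  have hτ2 : ∀ i, τ i ^ 2 = 1 := fun i => by fin_cases i <;> simp [hτ]
  have hinj : ∀ i j, σ i = σ j → τ i = τ j → i = j := by
    intro i j
    rw [hσ, hτ]
    fin_cases i <;> fin_cases j <;> norm_num
  have hex : ∀ {c s : ℝ}, c ^ 2 + s ^ 2 = 1 → ∀ i, ∃ ξ : Real.Angle,
      ξ.cos = σ i * c ∧ ξ.sin = τ i * s := fun hcs i =>
    exists_angle_cos_sin (by rw [mul_pow, mul_pow, hσ2, hτ2, one_mul, one_mul, hcs])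
  choose ξ₀ hcos₀ hsin₀ using hex h₀
  choose ξ₁ hcos₁ hsin₁ using hex h₁
  -- Reflections preserve `sin²`, which separates all starting points from all end points.
  have hne : ∀ i j, ξ₀ i ≠ ξ₁ j := fun i j hij => by
    have h2 : (ξ₀ i).sin ^ 2 = (ξ₁ j).sin ^ 2 := by rw [hij]
    rw [hsin₀, hsin₁, mul_pow, mul_pow, hτ2, hτ2] at h2
    linarith
  have hinj₀ : ∀ i j, ξ₀ i = ξ₀ j → i = j := fun i j hij => hinj i j
    (mul_right_cancel₀ hc₀ (by rw [← hcos₀, ← hcos₀, hij]))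
    (mul_right_cancel₀ hs₀ (by rw [← hsin₀, ← hsin₀, hij]))
  have hinj₁ : ∀ i j, ξ₁ i = ξ₁ j → i = j := fun i j hij => hinj i j
    (mul_right_cancel₀ hc₁ (by rw [← hcos₁, ← hcos₁, hij]))
    (mul_right_cancel₀ hs₁ (by rw [← hsin₁, ← hsin₁, hij]))
  have hbrake : ∀ i, ∃ α₀ α₁, IsTwoPeriodicBrake E ω h μ e (ξ₀ i, α₀) (ξ₁ i, α₁) := fun i => by
    have := H.reflect (hσ2 i) (hτ2 i)
    rw [← hcos₀, ← hsin₀, ← hcos₁, ← hsin₁] at this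
    exact this.exists_isTwoPeriodicBrake hω hE hh hμ he (hne i i)
  choose α₀ α₁ hα using hbrake
  refine ⟨fun i => (ξ₀ i, α₀ i), fun i => (ξ₁ i, α₁ i), hα, fun i j hij => ?_⟩
  refine Set.disjoint_left.2 ?_
  rintro p (rfl | rfl) (hp | hp)
  · exact hij (hinj₀ i j (congrArg Prod.fst hp))
  · exact hne i j (congrArg Prod.fst hp)
  · exact hne j i (congrArg Prod.fst hp).symm
  · exact hij (hinj₁ i j (congrArg Prod.fst hp))

end RefractionBilliard

theorem mainTheorem5 (E ω e : ℝ) (hE : 0 < E) (hω : 0 < ω) (hEω : E < ω ^ 2)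
    (hHill : ω ^ 2 / 2 < E) (he₀ : 0 < e) (he₁ : e < 1 / Real.sqrt 2) :
    ∃ μ₀ C : ℝ, 0 < μ₀ ∧ 0 < C ∧ ∀ μ h : ℝ, μ₀ < μ → C * μ < h →
      ∃ P Q : Fin 4 → RefractionBilliard.PhasePoint,
        (∀ i, RefractionBilliard.IsTwoPeriodicBrake E ω h μ e (P i) (Q i)) ∧
        Pairwise (fun i j => Disjoint ({P i, Q i} : Set RefractionBilliard.PhasePoint)
          {P j, Q j}) := by
  have he : e ^ 2 < 1 / 2 := by
    have := pow_lt_pow_left₀ he₁ he₀.le two_ne_zero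
    rwa [div_pow, Real.sq_sqrt zero_le_two, one_pow] at this
  have he1 : e ^ 2 < 1 := by linarith
  have hb := RefractionBilliard.semiMinor_pos he1
  have hb2 := RefractionBilliard.semiMinor_sq he1.le
  obtain ⟨δ, hδ, hsol⟩ := Metric.eventually_nhds_iff.1
    (RefractionBilliard.eventually_exists_linkEquations_eq_zero (E := E) (ω := ω) he₀ hb
      (by linarith) (by rw [hb2]; nlinarith [mul_nonneg (sq_nonneg ω) (sq_nonneg e)])
      (RefractionBilliard.linkEquations_nondegenerate he₀ hb))
  -- `h > μ / δ` gives `σ < δ`; together with `μ > 1 / δ` it gives `h > 1 / δ²`, hence `κ < δ`.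
  refine ⟨1 / δ, 1 / δ, by positivity, by positivity, fun μ h hμ hh => ?_⟩
  have hμ0 : 0 < μ := lt_trans (by positivity) hμ
  have hh0 : 0 < h := lt_trans (by positivity) hh
  have hσ0 : 0 < μ / (2 * (E + h)) := by positivity
  have hμh : μ < δ * h := by
    rw [div_mul_eq_mul_div, one_mul, div_lt_iff₀ hδ] at hh; linarith
  have hμδ : 1 < δ * μ := by rw [div_lt_iff₀ hδ] at hμ; linarith
  have hκ : 1 / √(2 * (E + h)) < δ := by
    have hroot : 1 / δ < √(2 * (E + h)) := by
      refine Real.lt_sqrt_of_sq_lt ?_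
      rw [div_pow, one_pow, div_lt_iff₀ (by positivity)]
      nlinarith
    rw [div_lt_iff₀ (by positivity)] at hroot ⊢
    linarith
  have hσ : μ / (2 * (E + h)) < δ := by
    rw [div_lt_iff₀ (by positivity)]; nlinarith
  obtain ⟨⟨A₁, A₂, y₀, y₁⟩, heq, hA, hy₀, hy₁, hsy₀, hsy₁, hJ₀, hJ₁⟩ :=
    hsol (y := (1 / √(2 * (E + h)), μ / (2 * (E + h)))) (by
      rw [Prod.dist_eq, Real.dist_0_eq_abs, Real.dist_0_eq_abs, abs_of_pos (by positivity),
        abs_of_pos hσ0]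
      exact max_lt hκ hσ)
  obtain ⟨l, T, x, y, u, v, H⟩ := RefractionBilliard.exists_isBrakeLink_of_linkEquations he₀ he1
    hμ0 (by positivity) rfl heq hA hsy₀ hsy₁ hJ₀ hJ₁
  simp only at hsy₀ hsy₁ hy₀ hy₁
  have hc₀ := Real.sq_sqrt (by linarith : 0 ≤ 1 - (μ / (2 * (E + h))) ^ 2 * y₀ ^ 2)
  have hc₁ := Real.sq_sqrt (by linarith : 0 ≤ 1 - (μ / (2 * (E + h))) ^ 2 * y₁ ^ 2)
  refine H.exists_four hω hHill hh0 hμ0 he (by rw [hc₀]; ring) (by rw [hc₁]; ring)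
    (Real.sqrt_pos.2 (by linarith)).ne' (by positivity) (neg_ne_zero.2 (by positivity)) ?_
  -- What remains is `s₀² < 1/4 < 3/4 < s₁²`, from the two bounds by `1/4`.
  rw [hc₁, mul_pow]
  linarith
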